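/- Let $m(x)$ be the column vector of the $10$ monomials of degree $3$ in $x_1,x_2,x_3$, and for $\sigma\in S_3$ let $D(\sigma)$ be the $10\times 10$ matrix, in this basis, of the substitution $x_i\mapsto x_{\sigma(i)}$ on $\mathbb{R}[x_1,x_2,x_3]_3$. For a symmetric form $f\in\mathbb{R}[x_1,x_2,x_3]_6$ the symmetry adapted Gram spectrahedron of $f$ is $$K_f^{S_3}=\{Q\in\mathbb{R}^{10\times 10}: Q \text{ symmetric positive semidefinite},\ D(\sigma)^TQD(\sigma)=Q \text{ for all }\sigma\in S_3,\ m(x)^TQ\,m(x)=f(x)\}.$$ A symmetric sextic form $f$ is determined by its seven coefficients $a(f)=(a_1,\dots,a_7)\in\mathbb{R}^7$ at $x_1^6,\ x_1^5x_2,\ x_1^4x_2^2,\ x_1^4x_2x_3,\ x_1^3x_2^3,\ x_1^3x_2^2x_3,\ x_1^2x_2^2x_3^2$; it is SOS if it is a finite sum of squares of real cubic forms. Theorem. If a generic symmetric form $f\in\mathbb{R}[x_1,x_2,x_3]_6$ is SOS, then $4$ is the minimal rank of the matrices in $K_f^{S_3}$, and it is attained at extreme points. Precisely: there is a nonzero polynomial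 $P\in\mathbb{R}[a_1,\dots,a_7]$ such that for every symmetric form $f\in\mathbb{R}[x_1,x_2,x_3]_6$ with $P(a(f))\neq 0$ that is SOS, every matrix in $K_f^{S_3}$ has rank at least $4$, and $K_f^{S_3}$ has an extreme point of rank $4$. -/

import Mathlib

open MvPolynomial

noncomputable section

/-- A form of degree `2d` in `n` variables is SOS if it is a sum of squares of forms of degree `d`. -/
def IsSOSForm (n d : ℕ) (f : MvPolynomial (Fin n) ℝ) : Prop :=
  ∃ (k : ℕ) (q : Fin k → MvPolynomial (Fin n) ℝ),
    (∀ i, (q i).IsHomogeneous d) ∧ f = ∑ i, q i ^ 2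

/-- The monomial of degree `d` attached to a multiset of `d` variables. These monomials are the
basis `m(x)` of the space of forms of degree `d`; it has `(n + d - 1).choose d` elements. -/
def monoForm {n d : ℕ} (s : Sym (Fin n) d) : MvPolynomial (Fin n) ℝ :=
  ((s : Multiset (Fin n)).map X).prod

/-- The matrix `D(σ)`, in the basis of monomials of degree `d`, of the linear substitution
`x_i ↦ x_{σ(i)}` on forms of degree `d` (see `rename_monoForm`). -/
def permRep {n d : ℕ} (σ : Equiv.Perm (Fin n)) : Matrix (Sym (Fin n) d) (Sym (Fin n) d) ℝ :=
  Matrix.of fun s t => if s = t.map σ then 1 else 0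

theorem rename_monoForm {n d : ℕ} (σ : Equiv.Perm (Fin n)) (t : Sym (Fin n) d) :
    rename σ (monoForm t) = ∑ s, permRep σ s t • monoForm s := by
  simp [permRep, monoForm, ite_smul, map_multiset_prod, Multiset.map_map]

/-- The polynomial `m(x)ᵀ Q m(x)`. -/
def gramForm {n d : ℕ} (Q : Matrix (Sym (Fin n) d) (Sym (Fin n) d) ℝ) :
    MvPolynomial (Fin n) ℝ :=
  ∑ s, ∑ t, C (Q s t) * (monoForm s * monoForm t)

/-- The symmetry adapted PSD cone of the symmetric group acting on forms of degree `d`. -/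
def symPSDCone (n d : ℕ) : Set (Matrix (Sym (Fin n) d) (Sym (Fin n) d) ℝ) :=
  {Q | Q.PosSemidef ∧ ∀ σ : Equiv.Perm (Fin n), (permRep σ).transpose * Q * permRep σ = Q}

/-- The symmetry adapted Gram spectrahedron of a symmetric form `f` of degree `2d`. -/
def symGramSpectrahedron (n d : ℕ) (f : MvPolynomial (Fin n) ℝ) :
    Set (Matrix (Sym (Fin n) d) (Sym (Fin n) d) ℝ) :=
  {Q | Q ∈ symPSDCone n d ∧ gramForm Q = f}

/-- The monomial `x₁^i x₂^j x₃^k` as an exponent vector. -/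
def ternaryExp (i j k : ℕ) : Fin 3 →₀ ℕ := Finsupp.equivFunOnFinite.symm ![i, j, k]

/-- The seven coefficients that parametrize a symmetric ternary sextic: those at
`x₁⁶, x₁⁵x₂, x₁⁴x₂², x₁⁴x₂x₃, x₁³x₂³, x₁³x₂²x₃, x₁²x₂²x₃²`. -/
def sexticCoeffs (f : MvPolynomial (Fin 3) ℝ) : Fin 7 → ℝ :=
  ![f.coeff (ternaryExp 6 0 0), f.coeff (ternaryExp 5 1 0), f.coeff (ternaryExp 4 2 0),
    f.coeff (ternaryExp 4 1 1), f.coeff (ternaryExp 3 3 0), f.coeff (ternaryExp 3 2 1),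
    f.coeff (ternaryExp 2 2 2)]

end

open scoped Matrix

/-! Under S₃ the cubic forms split into three trivial, three standard and one sign representation.
An invariant positive semidefinite Gram matrix thus amounts to 3×3 positive semidefinite blocks A
and B and a scalar c ≥ 0, and its rank is rank A + 2 rank B + [c ≠ 0]. With e the sum of the
variables and q, r the quadratic and cubic invariants of the deviations, the represented sextic has
seven coordinates `gramCoord A B c` in e⁶, e⁴q, e³r, e²q², eqr, q³, r²; the sign part contributes
c(q³ − r²).

Lower bound: blocks of total rank at most 3 form finitely many families with at most six parameters
each, so the coefficients of their sextics satisfy a nontrivial polynomial relation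
(`exists_relation_of_degenerateBlocks`).

Upper bound (`exists_low_rank_blocks`): blocks of f come from averaging any Gram matrix. Setting e =
1, q = t², r = t³ kills q³ − r² and leaves a nonnegative univariate sextic without linear term.
Writing it as two squares gives A and B of rank at most one, but c may become negative. In that case
a path from the old blocks to the new ones meets a point where reducing B to rank one, with its
Schur complement moved into A, makes c exactly 0; a further deformation makes A singular. The
possible rank bounds are 1+2+1, 2+2+0 and, when B vanishes, 3+0+1.

Extreme points: the matrices of the compact set K_f whose kernel contains ker Q form a face, and an
extreme point of this face has rank at most rank Q (`exists_extremePoint_rank_le`). -/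

/-! ### Nonnegative univariate polynomials as sums of two squares. -/

theorem Polynomial.exists_sq_add_sq_of_nonneg (p : Polynomial ℝ) (hp : ∀ x, 0 ≤ p.eval x) :
    ∃ q r : Polynomial ℝ, p = q ^ 2 + r ^ 2 := by
  induction hn : p.natDegree using Nat.strong_induction_on generalizing p with
  | _ n ih =>
  by_cases hd : p.natDegree = 0
  · obtain ⟨a, rfl⟩ := Polynomial.natDegree_eq_zero.mp hd
    refine ⟨Polynomial.C √a, 0, ?_⟩
    have ha : 0 ≤ a := by simpa using hp 0
    rw [← Polynomial.C_pow, Real.sq_sqrt ha]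
    simp
  have hp0 : p ≠ 0 := by rintro rfl; simp at hd
  obtain ⟨z, hz⟩ := IsAlgClosed.exists_aeval_eq_zero ℂ p
    (by rw [Polynomial.degree_eq_natDegree hp0]; exact_mod_cast hd)
  -- once a sum of two squares of degree two splits off, two-square identities finish
  have key : ∀ (u v : ℝ) (p' : Polynomial ℝ),
      p = ((Polynomial.X - Polynomial.C u) ^ 2 + Polynomial.C v ^ 2) * p' →
      (∀ x, 0 ≤ p'.eval x) → ∃ q r : Polynomial ℝ, p = q ^ 2 + r ^ 2 := by
    intro u v p' hpp hp'
    have hq : ((Polynomial.X - Polynomial.C u) ^ 2 + Polynomial.C v ^ 2 :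
        Polynomial ℝ).natDegree = 2 := by compute_degree!
    have hp'0 : p' ≠ 0 := by rintro rfl; simp at hpp; exact hp0 hpp
    have hdeg : p.natDegree = 2 + p'.natDegree := by
      conv_lhs => rw [hpp]
      rw [Polynomial.natDegree_mul (by rintro h; rw [h] at hq; simp at hq) hp'0, hq]
    obtain ⟨q, r, hqr⟩ := ih p'.natDegree (by omega) p' hp' rfl
    refine ⟨(Polynomial.X - Polynomial.C u) * q - Polynomial.C v * r,
      (Polynomial.X - Polynomial.C u) * r + Polynomial.C v * q, ?_⟩
    rw [hpp, hqr]; ring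
  by_cases him : z.im = 0
  · set x := z.re
    have hx : p.eval x = 0 := by
      have : z = (x : ℂ) := Complex.ext rfl (by simpa using him)
      rw [this, ← Complex.coe_algebraMap, Polynomial.aeval_algebraMap_apply] at hz
      simpa using hz
    obtain ⟨p₁, hp₁⟩ := Polynomial.dvd_iff_isRoot.mpr hx
    -- A real root of a nonnegative polynomial is a minimum, hence a double root.
    have hder : p.derivative.eval x = 0 := by
      rw [← Polynomial.deriv]
      exact IsLocalMin.deriv_eq_zero (Filter.Eventually.of_forall fun y => by simpa [hx] using hp y)
    have hx₁ : p₁.eval x = 0 := by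
      rw [hp₁] at hder; simpa using hder
    obtain ⟨p₂, hp₂⟩ := Polynomial.dvd_iff_isRoot.mpr hx₁
    have hpp : p = ((Polynomial.X - Polynomial.C x) ^ 2 + Polynomial.C 0 ^ 2) * p₂ := by
      rw [hp₁, hp₂]; simp; ring
    refine key x 0 p₂ hpp ?_
    -- Dividing by (y − x)² gives nonnegativity only for y ≠ x; density and continuity give the
    -- rest.
    have hsub : closure ({x}ᶜ : Set ℝ) ⊆ {y | 0 ≤ p₂.eval y} := by
      refine closure_minimal ?_ (isClosed_le continuous_const p₂.continuous)
      intro y hy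
      have h := hp y
      rw [hpp] at h
      have hpos : 0 < (y - x) ^ 2 := by
        have : y - x ≠ 0 := sub_ne_zero.mpr hy
        positivity
      simp at h
      exact nonneg_of_mul_nonneg_right h hpos
    intro y
    exact hsub (by rw [(dense_compl_singleton x).closure_eq]; trivial)
  · obtain ⟨p', hp'⟩ := p.quadratic_dvd_of_aeval_eq_zero_im_ne_zero hz him
    have hquad : p = ((Polynomial.X - Polynomial.C z.re) ^ 2 + Polynomial.C z.im ^ 2) * p' := by
      rw [hp']
      congr 1
      rw [← Complex.normSq_eq_norm_sq, Complex.normSq_apply]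
      simp only [map_mul, map_add, map_ofNat]
      ring
    refine key z.re z.im p' hquad fun x => ?_
    have h := hp x
    rw [hquad] at h
    have hpos : 0 < (x - z.re) ^ 2 + z.im ^ 2 := by positivity
    simp at h
    exact nonneg_of_mul_nonneg_right h hpos

/-- A real polynomial of degree at most six vanishing everywhere has zero coefficients. -/
theorem coeff_eq_zero_of_forall_sextic (c : Fin 7 → ℝ)
    (h : ∀ t : ℝ, c 0 + c 1 * t + c 2 * t ^ 2 + c 3 * t ^ 3 + c 4 * t ^ 4 + c 5 * t ^ 5
      + c 6 * t ^ 6 = 0) :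
    c 0 = 0 ∧ c 1 = 0 ∧ c 2 = 0 ∧ c 3 = 0 ∧ c 4 = 0 ∧ c 5 = 0 ∧ c 6 = 0 := by
  have h0 := h 0
  have h1 := h 1
  have h2 := h (-1)
  have h3 := h 2
  have h4 := h (-2)
  have h5 := h 3
  have h6 := h (-3)
  norm_num at h0 h1 h2 h3 h4 h5 h6
  refine ⟨?_, ?_, ?_, ?_, ?_, ?_, ?_⟩ <;> linarith

/-- Top coefficients enter as a sum of real squares, so they cannot cancel. -/
theorem Polynomial.natDegree_le_of_sq_add_sq {q r : Polynomial ℝ} {n : ℕ}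
    (h : (q ^ 2 + r ^ 2).natDegree ≤ 2 * n) : q.natDegree ≤ n ∧ r.natDegree ≤ n := by
  by_contra hcon
  set m := max q.natDegree r.natDegree with hm
  have hmn : n < m := by
    rw [hm, lt_max_iff]
    by_contra hh; push Not at hh; exact hcon hh
  have hc : (q ^ 2 + r ^ 2).coeff (2 * m) = 0 :=
    Polynomial.coeff_eq_zero_of_natDegree_lt (by omega)
  rw [Polynomial.coeff_add, Polynomial.coeff_pow_of_natDegree_le (le_max_left _ _),
    Polynomial.coeff_pow_of_natDegree_le (le_max_right _ _)] at hc
  have hq : q.coeff m = 0 := by nlinarith [sq_nonneg (q.coeff m), sq_nonneg (r.coeff m)]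
  have hr : r.coeff m = 0 := by nlinarith [sq_nonneg (q.coeff m), sq_nonneg (r.coeff m)]
  rcases max_choice q.natDegree r.natDegree with h' | h'
  · rw [hm, h', Polynomial.coeff_natDegree, Polynomial.leadingCoeff_eq_zero] at hq
    rw [← hm] at h'; rw [hq] at h'; simp at h'; omega
  · rw [hm, h', Polynomial.coeff_natDegree, Polynomial.leadingCoeff_eq_zero] at hr
    rw [← hm] at h'; rw [hr] at h'; simp at h'; omega

theorem exists_rotation_orthogonal (x y : ℝ) :
    ∃ c s : ℝ, c ^ 2 + s ^ 2 = 1 ∧ c * y - s * x = 0 := by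
  by_cases h : x ^ 2 + y ^ 2 = 0
  · exact ⟨1, 0, by norm_num, by nlinarith [sq_nonneg x, sq_nonneg y]⟩
  · have hpos : 0 < x ^ 2 + y ^ 2 := lt_of_le_of_ne (by positivity) (Ne.symm h)
    have hs := Real.sq_sqrt hpos.le
    have hs0 := (Real.sqrt_pos.mpr hpos).ne'
    refine ⟨x / √(x ^ 2 + y ^ 2), y / √(x ^ 2 + y ^ 2), ?_, by ring⟩
    rw [div_pow, div_pow, hs]; field_simp

/-- A nonnegative univariate sextic without linear term is the sum of a square of an element of
`span {1, t², t³}` and a square of an element of `span {t, t², t³}`. -/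
theorem exists_two_squares_of_nonneg_sextic (g₀ g₂ g₃ g₄ g₅ g₆ : ℝ)
    (hg : ∀ t : ℝ, 0 ≤ g₀ + g₂ * t ^ 2 + g₃ * t ^ 3 + g₄ * t ^ 4 + g₅ * t ^ 5 + g₆ * t ^ 6) :
    ∃ s w : Fin 3 → ℝ, s 0 ^ 2 = g₀ ∧ 2 * s 0 * s 1 + w 0 ^ 2 = g₂ ∧
      2 * s 0 * s 2 + 2 * w 0 * w 1 = g₃ ∧ s 1 ^ 2 + 2 * w 0 * w 2 + w 1 ^ 2 = g₄ ∧
      2 * s 1 * s 2 + 2 * w 1 * w 2 = g₅ ∧ s 2 ^ 2 + w 2 ^ 2 = g₆ := by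
  let g : Polynomial ℝ := .C g₀ + .C g₂ * .X ^ 2 + .C g₃ * .X ^ 3 + .C g₄ * .X ^ 4
    + .C g₅ * .X ^ 5 + .C g₆ * .X ^ 6
  obtain ⟨q, r, hqr⟩ := g.exists_sq_add_sq_of_nonneg (fun x => by simpa [g] using hg x)
  have hdeg : g.natDegree ≤ 2 * 3 := by simp only [g]; compute_degree
  rw [hqr] at hdeg
  obtain ⟨hq, hr⟩ := Polynomial.natDegree_le_of_sq_add_sq hdeg
  have hev : ∀ p : Polynomial ℝ, p.natDegree ≤ 3 → ∀ t, p.eval t =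
      p.coeff 0 + p.coeff 1 * t + p.coeff 2 * t ^ 2 + p.coeff 3 * t ^ 3 := by
    intro p hp t
    rw [Polynomial.eval_eq_sum_range' (Nat.lt_succ_of_le hp)]
    simp [Finset.sum_range_succ]
  generalize hq0 : q.coeff 0 = q₀ at *
  generalize hq1 : q.coeff 1 = q₁ at *
  generalize hq2 : q.coeff 2 = q₂ at *
  generalize hq3 : q.coeff 3 = q₃ at *
  generalize hr0 : r.coeff 0 = r₀ at *
  generalize hr1 : r.coeff 1 = r₁ at *
  generalize hr2 : r.coeff 2 = r₂ at *
  generalize hr3 : r.coeff 3 = r₃ at *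
  have hcoef := coeff_eq_zero_of_forall_sextic
    ![q₀ ^ 2 + r₀ ^ 2 - g₀, 2 * q₀ * q₁ + 2 * r₀ * r₁,
      2 * q₀ * q₂ + q₁ ^ 2 + 2 * r₀ * r₂ + r₁ ^ 2 - g₂,
      2 * q₀ * q₃ + 2 * q₁ * q₂ + 2 * r₀ * r₃ + 2 * r₁ * r₂ - g₃,
      2 * q₁ * q₃ + q₂ ^ 2 + 2 * r₁ * r₃ + r₂ ^ 2 - g₄,
      2 * q₂ * q₃ + 2 * r₂ * r₃ - g₅, q₃ ^ 2 + r₃ ^ 2 - g₆] (by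
    intro t
    have h1 : g.eval t = q.eval t ^ 2 + r.eval t ^ 2 := by rw [hqr]; simp
    rw [hev q hq, hev r hr, hq0, hq1, hq2, hq3, hr0, hr1, hr2, hr3] at h1
    simp [g] at h1
    simp
    linear_combination -h1)
  simp at hcoef
  obtain ⟨h0, h1, h2, h3, h4, h5, h6⟩ := hcoef
  -- The missing linear term says (q₀, r₀) ⊥ (q₁, r₁). One rotation of the pair (q, r) therefore
  -- removes the constant term of one polynomial and the linear term of the other; if q₀ = r₀ = 0,
  -- it only has to remove a linear term.
  obtain ⟨c, s, hcs, hw, hs⟩ : ∃ c s : ℝ, c ^ 2 + s ^ 2 = 1 ∧ c * r₀ - s * q₀ = 0 ∧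
      c * q₁ + s * r₁ = 0 := by
    by_cases hz : q₀ = 0 ∧ r₀ = 0
    · obtain ⟨c, s, hcs, h⟩ := exists_rotation_orthogonal (-r₁) q₁
      exact ⟨c, s, hcs, by simp [hz], by linarith⟩
    · obtain ⟨c, s, hcs, h⟩ := exists_rotation_orthogonal q₀ r₀
      refine ⟨c, s, hcs, h, ?_⟩
      have e1 : q₀ * (c * q₁ + s * r₁) = 0 := by linear_combination c / 2 * h1 - r₁ * h
      have e2 : r₀ * (c * q₁ + s * r₁) = 0 := by linear_combination s / 2 * h1 + q₁ * h
      by_contra hne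
      exact hz ⟨(mul_eq_zero.mp e1).resolve_right hne, (mul_eq_zero.mp e2).resolve_right hne⟩
  refine ⟨![c * q₀ + s * r₀, c * q₂ + s * r₂, c * q₃ + s * r₃],
    ![c * r₁ - s * q₁, c * r₂ - s * q₂, c * r₃ - s * q₃], ?_⟩
  simp
  refine ⟨?_, ?_, ?_, ?_, ?_, ?_⟩
  · linear_combination (q₀ ^ 2 + r₀ ^ 2) * hcs + h0 - (c * r₀ - s * q₀) * hw
  · linear_combination (2 * q₀ * q₂ + q₁ ^ 2 + 2 * r₀ * r₂ + r₁ ^ 2) * hcs + h2 -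
      2 * (c * r₂ - s * q₂) * hw - (c * q₁ + s * r₁) * hs
  · linear_combination (2 * q₀ * q₃ + 2 * q₁ * q₂ + 2 * r₀ * r₃ + 2 * r₁ * r₂) * hcs + h3 -
      2 * (c * r₃ - s * q₃) * hw - 2 * (c * q₂ + s * r₂) * hs
  · linear_combination (2 * q₁ * q₃ + q₂ ^ 2 + 2 * r₁ * r₃ + r₂ ^ 2) * hcs + h4 -
      2 * (c * q₃ + s * r₃) * hs
  · linear_combination (2 * q₂ * q₃ + 2 * r₂ * r₃) * hcs + h5
  · linear_combination (q₃ ^ 2 + r₃ ^ 2) * hcs + h6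

/-! ### Positive semidefinite matrices: singular points on paths, Schur complements. -/

/-- A continuous path of symmetric real matrices that leaves the positive semidefinite cone passes
through a singular positive semidefinite matrix. -/
theorem exists_posSemidef_det_eq_zero {n : Type*} [Fintype n] [DecidableEq n]
    {M : ℝ → Matrix n n ℝ} (hM : Continuous M) (hsymm : ∀ x, (M x).IsHermitian) {x₀ x₁ : ℝ}
    (h₀ : (M x₀).PosSemidef) (h₁ : ¬ (M x₁).PosSemidef) :
    ∃ x, (M x).PosSemidef ∧ (M x).det = 0 := by
  let K : Set (n → ℝ) := Metric.sphere 0 1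
  have hK : IsCompact K := isCompact_sphere 0 1
  let q : ℝ → (n → ℝ) → ℝ := fun x v => v ⬝ᵥ (M x *ᵥ v)
  have hq : Continuous ↿q := by
    change Continuous fun p : ℝ × (n → ℝ) => p.2 ⬝ᵥ (M p.1 *ᵥ p.2)
    exact continuous_snd.dotProduct ((hM.comp continuous_fst).matrix_mulVec continuous_snd)
  have hpsd : ∀ x, (∀ v ∈ K, 0 ≤ q x v) → (M x).PosSemidef := by
    intro x hx
    refine Matrix.PosSemidef.of_dotProduct_mulVec_nonneg (hsymm x) fun v => ?_
    by_cases hv : v = 0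
    · simp [hv]
    have hn : ‖v‖ ≠ 0 := norm_ne_zero_iff.mpr hv
    have h := hx (‖v‖⁻¹ • v) (by simp [K, norm_smul, hn])
    simp only [q, Matrix.mulVec_smul, dotProduct_smul, smul_dotProduct, smul_eq_mul] at h
    have : 0 < ‖v‖⁻¹ := by positivity
    rw [← mul_assoc] at h
    simpa using nonneg_of_mul_nonneg_right h (by positivity)
  have hne : K.Nonempty := by
    by_contra hemp
    exact h₁ (hpsd x₁ fun v hv => absurd ⟨v, hv⟩ hemp)
  -- The minimum of the quadratic form on the unit sphere (of the sup norm) replaces the least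
  -- eigenvalue: it is continuous in x, and where it vanishes a minimizer is a kernel vector.
  let μ : ℝ → ℝ := fun x => sInf (q x '' K)
  have hμ : Continuous μ := hK.continuous_sInf hq
  have hmin : ∀ x, ∃ v ∈ K, μ x = q x v ∧ ∀ u ∈ K, q x v ≤ q x u := by
    intro x
    exact hK.exists_sInf_image_eq_and_le hne (hq.comp (Continuous.prodMk_right x)).continuousOn
  have hμ₀ : 0 ≤ μ x₀ := by
    obtain ⟨v, -, hv, -⟩ := hmin x₀
    rw [hv]; simpa using h₀.dotProduct_mulVec_nonneg v
  have hμ₁ : μ x₁ ≤ 0 := by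
    by_contra hcon
    push Not at hcon
    obtain ⟨v, -, hv, hle⟩ := hmin x₁
    exact h₁ (hpsd x₁ fun u hu => (hv ▸ hcon.le).trans (hle u hu))
  obtain ⟨x, -, hx⟩ : (0 : ℝ) ∈ μ '' Set.univ :=
    isPreconnected_univ.intermediate_value (Set.mem_univ x₁) (Set.mem_univ x₀)
      hμ.continuousOn ⟨hμ₁, hμ₀⟩
  obtain ⟨v, hvK, hv, hle⟩ := hmin x
  have hP : (M x).PosSemidef := hpsd x fun u hu => by rw [← hx, hv]; exact hle u hu
  refine ⟨x, hP, Matrix.exists_mulVec_eq_zero_iff.mp ⟨v, ?_, ?_⟩⟩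
  · rintro rfl; simp [K] at hvK
  · exact (hP.dotProduct_mulVec_zero_iff v).mp (by simpa [hx] using hv.symm)

/-- The quadratic form of a `3 × 3` matrix, written out. -/
theorem dotProduct_mulVec_fin_three (A : Matrix (Fin 3) (Fin 3) ℝ) (v : Fin 3 → ℝ) :
    v ⬝ᵥ (A *ᵥ v) = A 0 0 * v 0 ^ 2 + A 1 1 * v 1 ^ 2 + A 2 2 * v 2 ^ 2
      + (A 0 1 + A 1 0) * (v 0 * v 1) + (A 0 2 + A 2 0) * (v 0 * v 2)
      + (A 1 2 + A 2 1) * (v 1 * v 2) := by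
  simp [Matrix.mulVec, dotProduct, Fin.sum_univ_three]; ring

namespace Matrix.PosSemidef

variable {n : Type*} {A : Matrix n n ℝ}

theorem apply_comm (hA : A.PosSemidef) (i j : n) : A i j = A j i := by
  simpa using hA.isHermitian.apply j i

theorem isSymm (hA : A.PosSemidef) : A.IsSymm := Matrix.IsSymm.ext fun i j => hA.apply_comm j i

theorem sq_apply_le (hA : A.PosSemidef) (i j : n) : A i j ^ 2 ≤ A i i * A j j := by
  classical
  have h := (hA.submatrix ![i, j]).det_nonneg
  rw [Matrix.det_fin_two] at h
  simp [hA.apply_comm j i] at h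
  nlinarith

theorem apply_eq_zero (hA : A.PosSemidef) {i : n} (hi : A i i = 0) (j : n) : A i j = 0 := by
  have := hA.sq_apply_le i j
  rw [hi, zero_mul] at this
  exact pow_eq_zero_iff two_ne_zero |>.mp (le_antisymm this (sq_nonneg _))

/-- Splitting off a row of a positive semidefinite matrix. -/
theorem sub_vecMulVec [Fintype n] (hA : A.PosSemidef) {i : n} (hi : 0 < A i i) :
    (A - (A i i)⁻¹ • Matrix.vecMulVec (A i) (A i)).PosSemidef := by
  classical
  refine Matrix.PosSemidef.of_dotProduct_mulVec_nonneg ?_ fun v => ?_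
  · ext j k
    simp [Matrix.vecMulVec_apply, hA.apply_comm j k, mul_comm]
  · have hcol : A.col i = A i := by ext j; exact hA.apply_comm j i
    have h := hA.dotProduct_mulVec_nonneg (v - ((A i i)⁻¹ * (A i ⬝ᵥ v)) • Pi.single i 1)
    have e1 : v ⬝ᵥ A i = A i ⬝ᵥ v := dotProduct_comm _ _
    have e2 : (A *ᵥ v) i = A i ⬝ᵥ v := rfl
    simp only [star_trivial, Matrix.mulVec_sub, Matrix.mulVec_smul, Matrix.mulVec_single_one,
      hcol, sub_dotProduct, dotProduct_sub, smul_dotProduct, dotProduct_smul, smul_eq_mul,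
      single_one_dotProduct, e1, e2] at h
    simp only [star_trivial, Matrix.sub_mulVec, Matrix.smul_mulVec, dotProduct_sub,
      dotProduct_smul, Matrix.vecMulVec_mulVec, smul_eq_mul, e1]
    have hne := hi.ne'
    simp
    field_simp at h ⊢
    linarith

end Matrix.PosSemidef

/-! ### Blocks with the same sextic, and reduction of their ranks. -/

/-- The coordinates, in the basis `sexticBasis`, of the symmetric sextic with blocks `A` (trivial
isotypic component), `B` (standard component) and `c` (sign component). -/
def gramCoord (A B : Matrix (Fin 3) (Fin 3) ℝ) (c : ℝ) : Fin 7 → ℝ :=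
  ![A 0 0, 2 * A 0 1 + B 0 0, 2 * A 0 2 + 2 * B 0 1, A 1 1 + 2 * B 0 2 + B 1 1,
    2 * A 1 2 + 2 * B 1 2, B 2 2 + c, A 2 2 - c]

theorem gramCoord_eq_iff {A B A' B' : Matrix (Fin 3) (Fin 3) ℝ} {c c' : ℝ} :
    gramCoord A' B' c' = gramCoord A B c ↔ A' 0 0 = A 0 0 ∧ 2 * A' 0 1 + B' 0 0 = 2 * A 0 1 + B 0 0 ∧
      2 * A' 0 2 + 2 * B' 0 1 = 2 * A 0 2 + 2 * B 0 1 ∧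
      A' 1 1 + 2 * B' 0 2 + B' 1 1 = A 1 1 + 2 * B 0 2 + B 1 1 ∧
      2 * A' 1 2 + 2 * B' 1 2 = 2 * A 1 2 + 2 * B 1 2 ∧ B' 2 2 + c' = B 2 2 + c ∧
      A' 2 2 - c' = A 2 2 - c := by
  simp [gramCoord, Matrix.vecCons_inj]

/-- Vary the first entry x of w and let A compensate. The (0,1) entry of A then moves like −x²/2,
while the product of the first two diagonal entries grows at most linearly, so the path leaves the
cone and passes through a singular matrix. -/
theorem exists_gramCoord_eq_of_det_eq_zero {A : Matrix (Fin 3) (Fin 3) ℝ} (hA : A.PosSemidef)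
    (w : Fin 3 → ℝ) (c : ℝ) : ∃ (A' : Matrix (Fin 3) (Fin 3) ℝ) (w' : Fin 3 → ℝ), A'.PosSemidef ∧
      A'.det = 0 ∧
      gramCoord A' (Matrix.vecMulVec w' w') c = gramCoord A (Matrix.vecMulVec w w) c := by
  let M : ℝ → Matrix (Fin 3) (Fin 3) ℝ := fun x =>
    !![A 0 0, A 0 1 + (w 0 ^ 2 - x ^ 2) / 2, A 0 2 + (w 0 - x) * w 1;
      A 0 1 + (w 0 ^ 2 - x ^ 2) / 2, A 1 1 + 2 * (w 0 - x) * w 2, A 1 2;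
      A 0 2 + (w 0 - x) * w 1, A 1 2, A 2 2]
  have hM : Continuous M := by
    refine continuous_matrix fun i j => ?_
    fin_cases i <;> fin_cases j <;> simp [M] <;> fun_prop
  have hsymm : ∀ x, (M x).IsHermitian := by
    intro x
    ext i j
    fin_cases i <;> fin_cases j <;> simp [M]
  have h₀ : (M (w 0)).PosSemidef := by
    convert hA using 1
    ext i j
    fin_cases i <;> fin_cases j <;>
      simp [M, hA.apply_comm 1 0, hA.apply_comm 2 0, hA.apply_comm 2 1]
  obtain ⟨x₁, hx₁⟩ : ∃ x₁, ¬ (M x₁).PosSemidef := by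
    set p := A 0 1 + w 0 ^ 2 / 2
    set q := A 0 0 * (A 1 1 + 2 * w 0 * w 2)
    set r := A 0 0 * (2 * w 2)
    -- At x = 2K the inequality for the upper left 2×2 minor would give K⁴ ≤ K + 2K², which fails
    -- for K ≥ 2.
    set K := 2 + |p| + |q| + |r|
    have hp := abs_nonneg p
    have hq := abs_nonneg q
    have hr := abs_nonneg r
    have hp' := le_abs_self p
    have hq' := le_abs_self q
    have hr' := neg_abs_le r
    have hK : 2 ≤ K := by simp only [K]; linarith
    refine ⟨2 * K, fun hcon => ?_⟩
    have h := hcon.sq_apply_le 0 1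
    have h' : (2 * K ^ 2 - p) ^ 2 ≤ q - r * (2 * K) := by
      simp only [M, Matrix.of_apply, Matrix.cons_val', Matrix.cons_val_zero, Matrix.cons_val_one,
        p, q, r] at h ⊢
      linarith
    have h1 : K ^ 2 ≤ 2 * K ^ 2 - p := by
      have : p ≤ K := by simp only [K]; linarith
      nlinarith
    have h2 : q - r * (2 * K) ≤ K + K * (2 * K) := by
      have h3 : q ≤ K := by simp only [K]; linarith
      have h4 : -r ≤ K := by simp only [K]; linarith
      nlinarith
    have h5 : (K ^ 2) ^ 2 ≤ (2 * K ^ 2 - p) ^ 2 := pow_le_pow_left₀ (by positivity) h1 2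
    have h6 : 4 * K ^ 2 ≤ (K ^ 2) ^ 2 := by
      have : 4 ≤ K ^ 2 := by nlinarith
      nlinarith
    nlinarith
  obtain ⟨x, hx, hdet⟩ := exists_posSemidef_det_eq_zero hM hsymm h₀ hx₁
  refine ⟨M x, ![x, w 1, w 2], hx, hdet, gramCoord_eq_iff.mpr ?_⟩
  simp [M, Matrix.vecMulVec_apply]
  refine ⟨?_, ?_, ?_⟩ <;> ring

/-- The standard block of rank one can be obtained by moving a Schur complement to the trivial
block. -/
theorem gramCoord_add_sub {A B : Matrix (Fin 3) (Fin 3) ℝ} (h : 0 < B 0 0)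
    (c : ℝ) : gramCoord (A + (B - (B 0 0)⁻¹ • Matrix.vecMulVec (B 0) (B 0)))
      ((B 0 0)⁻¹ • Matrix.vecMulVec (B 0) (B 0)) (c + B 2 2 - B 0 2 ^ 2 / B 0 0)
      = gramCoord A B c := by
  rw [gramCoord_eq_iff]
  have := h.ne'
  simp only [Matrix.add_apply, Matrix.sub_apply, Matrix.smul_apply, Matrix.vecMulVec_apply,
    smul_eq_mul]
  refine ⟨?_, ?_, ?_, ?_, ?_, ?_, ?_⟩ <;> field_simp <;> ring

theorem inv_smul_vecMulVec_eq {n : Type*} {a : ℝ} (ha : 0 ≤ a) (v : n → ℝ) :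
    a⁻¹ • Matrix.vecMulVec v v = Matrix.vecMulVec ((√a)⁻¹ • v) ((√a)⁻¹ • v) := by
  ext i j
  simp only [Matrix.smul_apply, Matrix.vecMulVec_apply, Pi.smul_apply, smul_eq_mul]
  have : a⁻¹ = (√a)⁻¹ * (√a)⁻¹ := by rw [← mul_inv, Real.mul_self_sqrt ha]
  rw [this]; ring

theorem posSemidef_vecMulVec_self {n : Type*} [Fintype n] (v : n → ℝ) :
    (Matrix.vecMulVec v v).PosSemidef := by
  simpa using Matrix.posSemidef_vecMulVec_self_star v

/-- Blocks of low rank with prescribed coordinates. -/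
theorem exists_low_rank_blocks {A B : Matrix (Fin 3) (Fin 3) ℝ} {c : ℝ} (hA : A.PosSemidef)
    (hB : B.PosSemidef) (hc : 0 ≤ c) :
    ∃ (A' : Matrix (Fin 3) (Fin 3) ℝ) (w : Fin 3 → ℝ) (c' : ℝ), A'.PosSemidef ∧ 0 ≤ c' ∧
      gramCoord A' (Matrix.vecMulVec w w) c' = gramCoord A B c ∧
      (w = 0 ∨ (∃ s, A' = Matrix.vecMulVec s s) ∨ (A'.det = 0 ∧ c' = 0)) := by
  -- If the (0,0) entry of the standard block is 0, so is its first row, and the whole block can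
  -- move into the trivial one. Its (2,2) entry thereby passes from q³ to r², which the sign
  -- coefficient corrects.
  have key0 : ∀ {A₁ B₁ : Matrix (Fin 3) (Fin 3) ℝ} {c₁ : ℝ}, A₁.PosSemidef → B₁.PosSemidef →
      0 ≤ c₁ + B₁ 2 2 → B₁ 0 0 = 0 →
      gramCoord A₁ B₁ c₁ = gramCoord A B c → ∃ A' : Matrix (Fin 3) (Fin 3) ℝ,
        ∃ (w : Fin 3 → ℝ) (c' : ℝ), A'.PosSemidef ∧ 0 ≤ c' ∧
      gramCoord A' (Matrix.vecMulVec w w) c' = gramCoord A B c ∧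
      (w = 0 ∨ (∃ s, A' = Matrix.vecMulVec s s) ∨ (A'.det = 0 ∧ c' = 0)) := by
    intro A₁ B₁ c₁ hA₁ hB₁ hc₁ h0 hg
    refine ⟨A₁ + B₁, 0, c₁ + B₁ 2 2, hA₁.add hB₁, hc₁, ?_, Or.inl rfl⟩
    rw [← hg, gramCoord_eq_iff]
    simp [h0, hB₁.apply_eq_zero h0]
    refine ⟨?_, ?_⟩ <;> ring
  by_cases hB0 : B 0 0 = 0
  · exact key0 hA hB (add_nonneg hc hB.diag_nonneg) hB0 rfl
  have hB0 : 0 < B 0 0 := lt_of_le_of_ne hB.diag_nonneg (Ne.symm hB0)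
  -- The sextic restricted to e = 1, q = t², r = t³: A acts on (1, t², t³), B on (t, t², t³), and c
  -- drops out since q³ = r².
  obtain ⟨s, w, h0, h2, h3, h4, h5, h6⟩ := exists_two_squares_of_nonneg_sextic (A 0 0)
    (2 * A 0 1 + B 0 0) (2 * A 0 2 + 2 * B 0 1) (A 1 1 + 2 * B 0 2 + B 1 1)
    (2 * A 1 2 + 2 * B 1 2) (A 2 2 + B 2 2) (by
      intro t
      have h1 := hA.dotProduct_mulVec_nonneg ![1, t ^ 2, t ^ 3]
      have h2 := hB.dotProduct_mulVec_nonneg ![t, t ^ 2, t ^ 3]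
      rw [star_trivial, dotProduct_mulVec_fin_three] at h1 h2
      simp [hA.apply_comm 1 0, hA.apply_comm 2 0, hA.apply_comm 2 1, hB.apply_comm 1 0,
        hB.apply_comm 2 0, hB.apply_comm 2 1] at h1 h2
      linarith)
  set S := Matrix.vecMulVec s s
  set W := Matrix.vecMulVec w w
  have hS : S.PosSemidef := posSemidef_vecMulVec_self s
  have hW : W.PosSemidef := posSemidef_vecMulVec_self w
  -- κ is the q³ coordinate of the sextic. It fixes the sign coefficient as κ minus the (2,2) entry
  -- of the standard block.
  set κ := B 2 2 + c with hκ
  have hκ0 : 0 ≤ κ := add_nonneg hB.diag_nonneg hc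
  have hSW : gramCoord S W (κ - w 2 ^ 2) = gramCoord A B c := by
    rw [gramCoord_eq_iff]
    simp only [S, W, Matrix.vecMulVec_apply, hκ]
    refine ⟨?_, ?_, ?_, ?_, ?_, ?_, ?_⟩ <;> linarith
  by_cases hw2 : w 2 ^ 2 ≤ κ
  · exact ⟨S, w, _, hS, sub_nonneg.mpr hw2, hSW, Or.inr (Or.inl ⟨s, rfl⟩)⟩
  push Not at hw2
  by_cases hw0 : w 0 = 0
  · refine key0 hS hW ?_ (by simp [W, Matrix.vecMulVec_apply, hw0]) hSW
    simp only [W, Matrix.vecMulVec_apply]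
    nlinarith
  have hW0 : 0 < W 0 0 := by simp only [W, Matrix.vecMulVec_apply]; exact mul_self_pos.mpr hw0
  -- Reducing Bt to the rank one part of its first row would leave sign coefficient κ − Bt₀₂²/Bt₀₀.
  -- This is nonnegative at t = 0, by the 2×2 minor of B, and negative at t = 1, so it vanishes in
  -- between.
  let Bt : ℝ → Matrix (Fin 3) (Fin 3) ℝ := fun t => (1 - t) • B + t • W
  have hBt : ∀ t ∈ Set.Icc (0 : ℝ) 1, (Bt t).PosSemidef := fun t ht =>
    (hB.smul (sub_nonneg.mpr ht.2)).add (hW.smul ht.1)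
  have hBt0 : ∀ t ∈ Set.Icc (0 : ℝ) 1, 0 < Bt t 0 0 := by
    intro t ht
    simp only [Bt, Matrix.add_apply, Matrix.smul_apply, smul_eq_mul]
    rcases ht.1.eq_or_lt with rfl | h
    · simpa using hB0
    · have := mul_nonneg (sub_nonneg.mpr ht.2) hB0.le
      have := mul_pos h hW0
      linarith
  have hcont : ContinuousOn (fun t => Bt t 0 2 ^ 2 / Bt t 0 0) (Set.Icc 0 1) := by
    refine ContinuousOn.div ?_ ?_ fun t ht => (hBt0 t ht).ne'
    · simp only [Bt, Matrix.add_apply, Matrix.smul_apply, smul_eq_mul]; fun_prop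
    · simp only [Bt, Matrix.add_apply, Matrix.smul_apply, smul_eq_mul]; fun_prop
  have hstart : Bt 0 0 2 ^ 2 / Bt 0 0 0 ≤ κ := by
    have := hB.sq_apply_le 0 2
    simp [Bt]
    rw [div_le_iff₀ hB0]
    nlinarith
  have hend : κ ≤ Bt 1 0 2 ^ 2 / Bt 1 0 0 := by
    simp [Bt, W, Matrix.vecMulVec_apply]
    rw [le_div_iff₀ (by positivity)]
    nlinarith [mul_self_pos.mpr hw0]
  obtain ⟨t, ht, hκt⟩ := intermediate_value_Icc (zero_le_one (α := ℝ)) hcont ⟨hstart, hend⟩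
  simp only at hκt
  have hAt : ((1 - t) • A + t • S).PosSemidef :=
    (hA.smul (sub_nonneg.mpr ht.2)).add (hS.smul ht.1)
  have hgt : gramCoord ((1 - t) • A + t • S) (Bt t) (κ - Bt t 2 2) = gramCoord A B c := by
    rw [gramCoord_eq_iff] at hSW ⊢
    obtain ⟨e0, e1, e2, e3, e4, e5, e6⟩ := hSW
    simp only [Bt, Matrix.add_apply, Matrix.smul_apply, smul_eq_mul, hκ] at *
    refine ⟨?_, ?_, ?_, ?_, ?_, ?_, ?_⟩
    · linear_combination t * e0
    · linear_combination t * e1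
    · linear_combination t * e2
    · linear_combination t * e3
    · linear_combination t * e4
    · ring
    · linear_combination t * e6 + t * e5
  have hred := gramCoord_add_sub (A := (1 - t) • A + t • S) (hBt0 t ht)
    (κ - Bt t 2 2)
  rw [hgt, hκt, show κ - Bt t 2 2 + Bt t 2 2 - κ = 0 by ring,
    inv_smul_vecMulVec_eq (hBt0 t ht).le] at hred
  have hP := hAt.add ((hBt t ht).sub_vecMulVec (hBt0 t ht))
  rw [inv_smul_vecMulVec_eq (hBt0 t ht).le] at hP
  obtain ⟨A', w', hA', hdet, hg'⟩ := exists_gramCoord_eq_of_det_eq_zero hP _ 0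
  exact ⟨A', w', 0, hA', le_rfl, hg'.trans hred, Or.inr (Or.inr ⟨hdet, rfl⟩)⟩

/-! ### Lower bound: parameter counts for blocks of small rank. -/

/-- Seven polynomials in six variables satisfy a polynomial relation. -/
theorem exists_relation_of_six_variables (φ : Fin 7 → MvPolynomial (Fin 6) ℝ) :
    ∃ P : MvPolynomial (Fin 7) ℝ, P ≠ 0 ∧ ∀ y, eval (fun i => eval y (φ i)) P = 0 := by
  have hdep : ¬ AlgebraicIndependent ℝ φ := by
    intro h
    have := h.lift_cardinalMk_le_trdeg
    rw [MvPolynomial.trdeg_of_isDomain] at this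
    simp at this
    norm_cast at this
  rw [algebraicIndependent_iff] at hdep
  push Not at hdep
  obtain ⟨P, hP, hne⟩ := hdep
  refine ⟨P, hne, fun y => ?_⟩
  have h := congrArg (aeval (R := ℝ) y) hP
  rw [map_zero, comp_aeval_apply] at h
  simpa [aeval_eq_eval] using h

noncomputable section

/-- The sum of the variables. -/
def sumVar : MvPolynomial (Fin 3) ℝ := X 0 + X 1 + X 2

/-- The three linear forms `3 x_k - (x₀ + x₁ + x₂)`, which sum to zero. -/
def devVar (k : Fin 3) : MvPolynomial (Fin 3) ℝ := 3 * X k - sumVar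

/-- The quadratic invariant of the deviations. -/
def devQuad : MvPolynomial (Fin 3) ℝ :=
  C (1 / 6) * (devVar 0 ^ 2 + devVar 1 ^ 2 + devVar 2 ^ 2)

/-- The cubic invariant of the deviations. -/
def devCub : MvPolynomial (Fin 3) ℝ := C (1 / 2) * (devVar 0 * devVar 1 * devVar 2)

/-- The alternating cubic form. -/
def devAlt : MvPolynomial (Fin 3) ℝ :=
  (devVar 0 - devVar 1) * (devVar 0 - devVar 2) * (devVar 1 - devVar 2)

/-- A basis of the symmetric ternary sextics. -/
def sexticBasis : Fin 7 → MvPolynomial (Fin 3) ℝ :=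
  ![sumVar ^ 6, sumVar ^ 4 * devQuad, sumVar ^ 3 * devCub, sumVar ^ 2 * devQuad ^ 2,
    sumVar * devQuad * devCub, devQuad ^ 3, devCub ^ 2]

/-- The symmetric ternary sextic with given coordinates. -/
def symSextic (φ : Fin 7 → ℝ) : MvPolynomial (Fin 3) ℝ := ∑ i, C (φ i) * sexticBasis i

end

theorem sexticCoeffs_symSextic (φ : Fin 7 → ℝ) (j : Fin 7) :
    sexticCoeffs (symSextic φ) j = ∑ i, φ i * sexticCoeffs (sexticBasis i) j := by
  fin_cases j <;> simp [sexticCoeffs, symSextic, coeff_sum, coeff_C_mul]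

/-- The monomial coefficients are linear in the coordinates, hence again polynomials in six
parameters. Independence of `sexticBasis` plays no role. -/
theorem exists_relation_of_symSextic (ψ : Fin 7 → MvPolynomial (Fin 6) ℝ) :
    ∃ P : MvPolynomial (Fin 7) ℝ, P ≠ 0 ∧
      ∀ y, eval (sexticCoeffs (symSextic fun i => eval y (ψ i))) P = 0 := by
  obtain ⟨P, hP, h⟩ := exists_relation_of_six_variables
    fun j => ∑ i, ψ i * C (sexticCoeffs (sexticBasis i) j)
  refine ⟨P, hP, fun y => ?_⟩
  rw [← h y]
  congr 2
  ext j
  simp [sexticCoeffs_symSextic]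

/-- Blocks `A`, `B`, `c` from which no generic symmetric sextic arises. -/
def DegenerateBlocks (A B : Matrix (Fin 3) (Fin 3) ℝ) (c : ℝ) : Prop :=
  (B = 0 ∧ (c = 0 ∨ A.det = 0)) ∨
    ∃ w, B = Matrix.vecMulVec w w ∧ (A = 0 ∨ ((∃ s, A = Matrix.vecMulVec s s) ∧ c = 0))

theorem exists_relation_of_degenerateBlocks :
    ∃ P : MvPolynomial (Fin 7) ℝ, P ≠ 0 ∧ ∀ (A B : Matrix (Fin 3) (Fin 3) ℝ) (c : ℝ),
      A.IsSymm → DegenerateBlocks A B c →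
        eval (sexticCoeffs (symSextic (gramCoord A B c))) P = 0 := by
  -- B = 0 and c = 0: the parameters are the six entries of A.
  obtain ⟨P₁, hP₁, h₁⟩ := exists_relation_of_symSextic ![X 0, 2 * X 1, 2 * X 2, X 3, 2 * X 4, 0, X 5]
  -- singular trivial block, by the position of a nonzero entry of a kernel vector
  obtain ⟨P₂, hP₂, h₂⟩ := exists_relation_of_symSextic
    ![X 3 ^ 2 * X 0 + 2 * X 3 * X 4 * X 1 + X 4 ^ 2 * X 2, -2 * (X 3 * X 0 + X 4 * X 1),
      -2 * (X 3 * X 1 + X 4 * X 2), X 0, 2 * X 1, X 5, X 2 - X 5]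
  obtain ⟨P₃, hP₃, h₃⟩ := exists_relation_of_symSextic
    ![X 0, -2 * (X 3 * X 0 + X 4 * X 1), 2 * X 1,
      X 3 ^ 2 * X 0 + 2 * X 3 * X 4 * X 1 + X 4 ^ 2 * X 2,
      -2 * (X 3 * X 1 + X 4 * X 2), X 5, X 2 - X 5]
  obtain ⟨P₄, hP₄, h₄⟩ := exists_relation_of_symSextic
    ![X 0, 2 * X 1, -2 * (X 3 * X 0 + X 4 * X 1), X 2, -2 * (X 3 * X 1 + X 4 * X 2), X 5,
      X 3 ^ 2 * X 0 + 2 * X 3 * X 4 * X 1 + X 4 ^ 2 * X 2 - X 5]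
  -- A = 0 and B of rank at most one: the parameters are w and c, and two variables stay idle.
  obtain ⟨P₅, hP₅, h₅⟩ := exists_relation_of_symSextic
    ![0, X 0 ^ 2, 2 * (X 0 * X 1), 2 * (X 0 * X 2) + X 1 ^ 2, 2 * (X 1 * X 2), X 2 ^ 2 + X 3, -X 3]
  -- A and B of rank at most one and c = 0: the parameters are w and s.
  obtain ⟨P₆, hP₆, h₆⟩ := exists_relation_of_symSextic
    ![X 3 ^ 2, 2 * (X 3 * X 4) + X 0 ^ 2, 2 * (X 3 * X 5) + 2 * (X 0 * X 1),
      X 4 ^ 2 + 2 * (X 0 * X 2) + X 1 ^ 2, 2 * (X 4 * X 5) + 2 * (X 1 * X 2), X 2 ^ 2, X 5 ^ 2]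
  refine ⟨P₁ * P₂ * P₃ * P₄ * P₅ * P₆, by simp [*], fun A B c hA hdeg => ?_⟩
  have s10 : A 1 0 = A 0 1 := hA.apply 0 1
  have s20 : A 2 0 = A 0 2 := hA.apply 0 2
  have s21 : A 2 1 = A 1 2 := hA.apply 1 2
  simp only [map_mul, mul_eq_zero]
  have transfer : ∀ {φ : Fin 7 → ℝ} {P : MvPolynomial (Fin 7) ℝ},
      eval (sexticCoeffs (symSextic φ)) P = 0 → gramCoord A B c = φ →
      eval (sexticCoeffs (symSextic (gramCoord A B c))) P = 0 := by
    rintro φ P h rfl; exact h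
  rcases hdeg with ⟨rfl, rfl | hdet⟩ | ⟨w, rfl, rfl | ⟨⟨s, rfl⟩, rfl⟩⟩
  · refine Or.inl <| Or.inl <| Or.inl <| Or.inl <| Or.inl <|
      transfer (h₁ ![A 0 0, A 0 1, A 0 2, A 1 1, A 1 2, A 2 2]) ?_
    ext i; fin_cases i <;> simp [gramCoord]
  · obtain ⟨v, hv, hAv⟩ := Matrix.exists_mulVec_eq_zero_iff.mpr hdet
    have r0 := congrFun hAv 0
    have r1 := congrFun hAv 1
    have r2 := congrFun hAv 2
    simp only [Matrix.mulVec, dotProduct, Fin.sum_univ_three, Pi.zero_apply, s10, s20, s21]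
      at r0 r1 r2
    by_cases v0 : v 0 = 0
    · by_cases v1 : v 1 = 0
      · have v2 : v 2 ≠ 0 := fun h => hv (by ext i; fin_cases i <;> simp [v0, v1, h])
        refine Or.inl <| Or.inl <| Or.inr <|
          transfer (h₄ ![A 0 0, A 0 1, A 1 1, v 0 / v 2, v 1 / v 2, c]) ?_
        simp only [v0, v1, mul_zero, zero_add, mul_eq_zero, v2, or_false] at r0 r1 r2
        ext i; fin_cases i <;> simp [gramCoord, v0, v1, r0, r1, r2]
      · refine Or.inl <| Or.inl <| Or.inl <| Or.inr <|
          transfer (h₃ ![A 0 0, A 0 2, A 2 2, v 0 / v 1, v 2 / v 1, c]) ?_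
        simp only [v0, mul_zero, zero_add] at r0 r1 r2
        have e0 : A 0 1 = -(A 0 2 * v 2) / v 1 := by field_simp; linarith
        have e2 : A 1 2 = -(A 2 2 * v 2) / v 1 := by field_simp; linarith
        have e1 : A 1 1 = A 2 2 * v 2 ^ 2 / v 1 ^ 2 := by
          rw [e2] at r1; field_simp at r1 ⊢; linarith
        ext i; fin_cases i <;> simp [gramCoord, v0, e0, e1, e2] <;> field_simp
    · refine Or.inl <| Or.inl <| Or.inl <| Or.inl <| Or.inr <|
          transfer (h₂ ![A 1 1, A 1 2, A 2 2, v 1 / v 0, v 2 / v 0, c]) ?_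
      have e1 : A 0 1 = -(A 1 1 * v 1 + A 1 2 * v 2) / v 0 := by field_simp; linarith
      have e2 : A 0 2 = -(A 1 2 * v 1 + A 2 2 * v 2) / v 0 := by field_simp; linarith
      have e0 : A 0 0 = (A 1 1 * v 1 ^ 2 + 2 * A 1 2 * v 1 * v 2 + A 2 2 * v 2 ^ 2) / v 0 ^ 2 := by
        rw [e1, e2] at r0; field_simp at r0 ⊢; linarith
      ext i; fin_cases i <;> simp [gramCoord, e0, e1, e2] <;> field_simp <;> ring
  · refine Or.inl <| Or.inr <| transfer (h₅ ![w 0, w 1, w 2, c, 0, 0]) ?_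
    ext i; fin_cases i <;> simp [gramCoord, Matrix.vecMulVec_apply, pow_two]
  · refine Or.inr <| transfer (h₆ ![w 0, w 1, w 2, s 0, s 1, s 2]) ?_
    ext i; fin_cases i <;> simp [gramCoord, Matrix.vecMulVec_apply, pow_two]

/-! ### Rank inequalities and matrices of extremal rank. -/

section Rank

variable {K m n o p : Type*} [Field K] [Fintype n] [Fintype p]

theorem Matrix.rank_add_le_rank_add_rank [Fintype m] (A B : Matrix m n K) :
    (A + B).rank ≤ A.rank + B.rank := by
  rw [Matrix.rank, Matrix.rank, Matrix.rank, Matrix.mulVecLin_add]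
  refine (Submodule.finrank_mono (?_ : _ ≤ LinearMap.range A.mulVecLin ⊔
    LinearMap.range B.mulVecLin)).trans (Submodule.finrank_add_le_finrank_add_finrank _ _)
  rintro _ ⟨v, rfl⟩
  exact Submodule.add_mem_sup ⟨v, rfl⟩ ⟨v, rfl⟩

theorem Matrix.rank_add_rank_le_rank_fromBlocks [Fintype m] [Fintype o] (A : Matrix m n K)
    (D : Matrix o p K) : A.rank + D.rank ≤ (Matrix.fromBlocks A 0 0 D).rank := by
  let e := LinearEquiv.sumArrowLequivProdArrow m o K K
  have h : ((LinearMap.range A.mulVecLin).prod (LinearMap.range D.mulVecLin)) ≤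
      (LinearMap.range (Matrix.fromBlocks A 0 0 D).mulVecLin).map e.toLinearMap := by
    rintro ⟨_, _⟩ ⟨⟨u, rfl⟩, ⟨v, rfl⟩⟩
    refine ⟨_, ⟨Sum.elim u v, rfl⟩, ?_⟩
    simp [e, Matrix.fromBlocks_mulVec]
    constructor
  have := Submodule.finrank_mono h
  rw [LinearEquiv.finrank_map_eq] at this
  rw [Matrix.rank, Matrix.rank, Matrix.rank]
  refine le_trans (le_of_eq ?_) this
  rw [← Module.finrank_prod, ← LinearMap.finrank_range_of_inj
    (f := (LinearMap.range A.mulVecLin).subtype.prodMap (LinearMap.range D.mulVecLin).subtype)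
    (Function.Injective.prodMap Subtype.val_injective Subtype.val_injective),
    LinearMap.range_prodMap, Submodule.range_subtype, Submodule.range_subtype]

end Rank

/-- A positive semidefinite matrix of rank at most one is a square. -/
theorem Matrix.PosSemidef.exists_eq_vecMulVec {n : Type*} [Fintype n] {A : Matrix n n ℝ}
    (hA : A.PosSemidef) (h : A.rank ≤ 1) : ∃ v, A = Matrix.vecMulVec v v := by
  classical
  by_cases h0 : ∀ i, A i i = 0
  · refine ⟨0, ?_⟩
    ext i j
    simp [hA.apply_eq_zero (h0 i) j]
  push Not at h0
  obtain ⟨i, hi⟩ := h0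
  have hi : 0 < A i i := lt_of_le_of_ne hA.diag_nonneg (Ne.symm hi)
  refine ⟨(√(A i i))⁻¹ • A i, ?_⟩
  rw [← inv_smul_vecMulVec_eq hi.le]
  obtain ⟨v, hv⟩ := finrank_le_one_iff.mp h
  have hcol : ∀ j, ∃ c : ℝ, ∀ k, c * v.1 k = A k j := by
    intro j
    obtain ⟨c, hc⟩ := hv ⟨A *ᵥ Pi.single j 1, ⟨_, rfl⟩⟩
    refine ⟨c, fun k => ?_⟩
    have := congrFun (congrArg Subtype.val hc) k
    simpa using this
  choose c hc using hcol
  ext j k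
  simp only [Matrix.smul_apply, Matrix.vecMulVec_apply, smul_eq_mul]
  field_simp
  rw [hA.apply_comm i j, ← hc, ← hc, ← hc, ← hc]
  ring

theorem Matrix.eq_zero_of_rank_eq_zero {m n : Type*} [Fintype m] [Fintype n] {A : Matrix m n ℝ}
    (h : A.rank = 0) : A = 0 := by
  classical
  rw [Matrix.rank, Submodule.finrank_eq_zero, LinearMap.range_eq_bot] at h
  ext i j
  simpa using congrFun (LinearMap.congr_fun h (Pi.single j 1)) i

theorem Matrix.det_eq_zero_of_rank_lt {n : Type*} [Fintype n] [DecidableEq n] {A : Matrix n n ℝ}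
    (h : A.rank < Fintype.card n) : A.det = 0 := by
  by_contra hne
  rw [Matrix.rank_of_isUnit A ((Matrix.isUnit_iff_isUnit_det A).mpr (isUnit_iff_ne_zero.mpr hne))]
    at h
  exact lt_irrefl _ h

theorem Matrix.rank_lt_of_det_eq_zero {n : Type*} [Fintype n] [DecidableEq n] {A : Matrix n n ℝ}
    (h : A.det = 0) : A.rank < Fintype.card n := by
  obtain ⟨v, hv, hAv⟩ := Matrix.exists_mulVec_eq_zero_iff.mpr h
  have := A.mulVecLin.finrank_range_add_finrank_ker
  have hpos : 0 < Module.finrank ℝ (LinearMap.ker A.mulVecLin) :=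
    Module.finrank_pos_iff_exists_ne_zero.mpr ⟨⟨v, hAv⟩, fun h => hv (congrArg Subtype.val h)⟩
  rw [Module.finrank_fintype_fun_eq_card] at this
  rw [Matrix.rank]
  omega

/-! ### Gram matrices as kernels m(x)ᵀ Q m(y); compactness and extreme points. -/

noncomputable section

variable {n d : ℕ}

/-- The vector `m(x)` of the values at `x` of the monomials of degree `d`. -/
def monoVec (d : ℕ) (x : Fin n → ℝ) : Sym (Fin n) d → ℝ := fun s => eval x (monoForm s)

theorem monoVec_apply (x : Fin n → ℝ) (s : Sym (Fin n) d) :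
    monoVec d x s = ((s : Multiset (Fin n)).map x).prod := by
  simp [monoVec, monoForm, map_multiset_prod, Multiset.map_map]

theorem monoForm_eq_monomial (s : Sym (Fin n) d) :
    monoForm s = monomial (Multiset.toFinsupp (s : Multiset (Fin n))) (1 : ℝ) := by
  rw [monoForm]
  induction (s : Multiset (Fin n)) using Multiset.induction_on with
  | empty => simp
  | cons a t ih =>
    rw [Multiset.map_cons, Multiset.prod_cons, ih, ← Multiset.singleton_add, map_add,
      Multiset.toFinsupp_singleton, X, monomial_mul, one_mul]

theorem coeff_sum_monoForm (v : Sym (Fin n) d → ℝ) (s : Sym (Fin n) d) :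
    coeff (Multiset.toFinsupp (s : Multiset (Fin n))) (∑ t, C (v t) * monoForm t) = v s := by
  classical
  simp only [coeff_sum, coeff_C_mul, monoForm_eq_monomial, coeff_monomial,
    EmbeddingLike.apply_eq_iff_eq, Sym.coe_inj, mul_ite, mul_one, mul_zero]
  simp

theorem eval_sum_monoForm (v : Sym (Fin n) d → ℝ) (x : Fin n → ℝ) :
    eval x (∑ t, C (v t) * monoForm t) = v ⬝ᵥ monoVec d x := by
  simp [dotProduct, monoVec]

theorem eq_zero_of_forall_dotProduct_monoVec {v : Sym (Fin n) d → ℝ}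
    (h : ∀ x, v ⬝ᵥ monoVec d x = 0) : v = 0 := by
  have h0 : ∑ t, C (v t) * monoForm t = 0 := MvPolynomial.funext fun x => by
    rw [eval_sum_monoForm, h, map_zero]
  ext s
  rw [← coeff_sum_monoForm v s, h0]
  simp

/-- A functional vanishing on every m(x) is a form vanishing at every point, hence zero. -/
theorem span_range_monoVec : Submodule.span ℝ (Set.range (monoVec (n := n) d)) = ⊤ := by
  by_contra hne
  obtain ⟨f, hf, hle⟩ := Submodule.exists_le_ker_of_lt_top _ (lt_top_iff_ne_top.mpr hne)
  have hrep : ∀ u, f u = (fun s => f (Pi.single s 1)) ⬝ᵥ u := by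
    intro u
    rw [LinearMap.pi_apply_eq_sum_univ f u]
    simp only [dotProduct, smul_eq_mul, mul_comm]
    refine Finset.sum_congr rfl fun s _ => ?_
    congr 2
    ext t
    simp [Pi.single_apply, eq_comm]
  have hz : (fun s => f (Pi.single s 1)) = 0 := eq_zero_of_forall_dotProduct_monoVec fun x => by
    rw [← hrep]
    exact hle (Submodule.subset_span ⟨x, rfl⟩)
  refine hf (LinearMap.ext fun u => ?_)
  rw [hrep, hz]
  simp

/-- Every form of degree `d` is a linear combination of the monomials of degree `d`. -/
theorem exists_dotProduct_monoVec_eq {p : MvPolynomial (Fin n) ℝ} (hp : p.IsHomogeneous d) :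
    ∃ v : Sym (Fin n) d → ℝ, ∀ x, v ⬝ᵥ monoVec d x = eval x p := by
  refine ⟨fun s => coeff (Multiset.toFinsupp (s : Multiset (Fin n))) p, fun x => ?_⟩
  rw [← eval_sum_monoForm]
  congr 1
  ext m
  by_cases hm : m.degree = d
  · have hs : (Finsupp.toMultiset m).card = d := by
      rw [Finsupp.card_toMultiset]; exact hm
    obtain ⟨s, rfl⟩ : ∃ s : Sym (Fin n) d, m = Multiset.toFinsupp (s : Multiset (Fin n)) :=
      ⟨⟨Finsupp.toMultiset m, hs⟩, (Finsupp.toMultiset_toFinsupp m).symm⟩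
    rw [coeff_sum_monoForm]
  · rw [hp.coeff_eq_zero hm, coeff_sum]
    refine Finset.sum_eq_zero fun s _ => ?_
    rw [coeff_C_mul, monoForm_eq_monomial, coeff_monomial, if_neg, mul_zero]
    rintro rfl
    refine hm ?_
    have := Finsupp.card_toMultiset (Multiset.toFinsupp (s : Multiset (Fin n)))
    rw [Multiset.toFinsupp_toMultiset, Sym.card_coe] at this
    exact this.symm

theorem eval_gramForm (Q : Matrix (Sym (Fin n) d) (Sym (Fin n) d) ℝ) (x : Fin n → ℝ) :
    eval x (gramForm Q) = monoVec d x ⬝ᵥ (Q *ᵥ monoVec d x) := by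
  simp only [gramForm, map_sum, map_mul, eval_C, dotProduct, Matrix.mulVec, Finset.mul_sum]
  refine Finset.sum_congr rfl fun s _ => Finset.sum_congr rfl fun t _ => ?_
  simp only [monoVec]; ring

theorem gramForm_eq_iff {Q : Matrix (Sym (Fin n) d) (Sym (Fin n) d) ℝ}
    {f : MvPolynomial (Fin n) ℝ} :
    gramForm Q = f ↔ ∀ x, monoVec d x ⬝ᵥ (Q *ᵥ monoVec d x) = eval x f := by
  simp only [← eval_gramForm]
  exact ⟨fun h x => by rw [h], fun h => MvPolynomial.funext h⟩

theorem matrix_ext_of_monoVec {Q Q' : Matrix (Sym (Fin n) d) (Sym (Fin n) d) ℝ}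
    (h : ∀ x y, monoVec d x ⬝ᵥ (Q *ᵥ monoVec d y) = monoVec d x ⬝ᵥ (Q' *ᵥ monoVec d y)) :
    Q = Q' := by
  have h1 : ∀ y, (Q - Q') *ᵥ monoVec d y = 0 := fun y =>
    eq_zero_of_forall_dotProduct_monoVec fun x => by
      rw [dotProduct_comm, Matrix.sub_mulVec, dotProduct_sub, h, sub_self]
  refine sub_eq_zero.mp ?_
  ext s t
  exact congrFun (eq_zero_of_forall_dotProduct_monoVec (v := (Q - Q') s)
    fun y => congrFun (h1 y) s) t

theorem permRep_mulVec_monoVec (σ : Equiv.Perm (Fin n)) (x : Fin n → ℝ) :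
    permRep σ *ᵥ monoVec d x = monoVec d (x ∘ σ.symm) := by
  ext s
  have hs : ∀ t : Sym (Fin n) d, s = t.map σ ↔ t = s.map σ.symm := by
    intro t
    constructor
    · rintro rfl; simp [Sym.map_map]
    · rintro rfl; simp [Sym.map_map]
  simp only [Matrix.mulVec, dotProduct, permRep, Matrix.of_apply, hs, ite_mul, one_mul, zero_mul,
    Finset.sum_ite_eq', Finset.mem_univ, if_true, monoVec_apply, Sym.coe_map, Multiset.map_map]

theorem dotProduct_conj_permRep_mulVec (Q : Matrix (Sym (Fin n) d) (Sym (Fin n) d) ℝ)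
    (σ : Equiv.Perm (Fin n)) (u v : Sym (Fin n) d → ℝ) :
    u ⬝ᵥ (((permRep σ)ᵀ * Q * permRep σ) *ᵥ v) =
      (permRep σ *ᵥ u) ⬝ᵥ (Q *ᵥ (permRep σ *ᵥ v)) := by
  rw [← Matrix.mulVec_mulVec, ← Matrix.mulVec_mulVec, Matrix.dotProduct_mulVec u,
    Matrix.vecMul_transpose]

/-- Invariance of a matrix in terms of the kernel `m(x)ᵀ Q m(y)`. -/
theorem forall_conj_permRep_eq_iff {Q : Matrix (Sym (Fin n) d) (Sym (Fin n) d) ℝ} :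
    (∀ σ : Equiv.Perm (Fin n), (permRep σ)ᵀ * Q * permRep σ = Q) ↔
      ∀ (σ : Equiv.Perm (Fin n)) (x y), monoVec d (x ∘ σ) ⬝ᵥ (Q *ᵥ monoVec d (y ∘ σ)) =
        monoVec d x ⬝ᵥ (Q *ᵥ monoVec d y) := by
  constructor
  · intro h σ x y
    conv_rhs => rw [← h σ.symm, dotProduct_conj_permRep_mulVec]
    simp [permRep_mulVec_monoVec]
  · intro h σ
    refine matrix_ext_of_monoVec fun x y => ?_
    rw [dotProduct_conj_permRep_mulVec, permRep_mulVec_monoVec, permRep_mulVec_monoVec, h]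

theorem dotProduct_vecMulVec_mulVec {ι : Type*} [Fintype ι] (u v w z : ι → ℝ) :
    u ⬝ᵥ (Matrix.vecMulVec v w *ᵥ z) = (v ⬝ᵥ u) * (w ⬝ᵥ z) := by
  rw [Matrix.vecMulVec_mulVec, dotProduct_smul, dotProduct_comm u v]
  simp

/-- The symmetry adapted Gram spectrahedron of a symmetric sum of squares is nonempty. -/
theorem symGramSpectrahedron_nonempty {f : MvPolynomial (Fin n) ℝ} (hf : f.IsSymmetric)
    (hsos : IsSOSForm n d f) : (symGramSpectrahedron n d f).Nonempty := by
  obtain ⟨k, q, hq, rfl⟩ := hsos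
  choose v hv using fun i => exists_dotProduct_monoVec_eq (hq i)
  set f := ∑ i, q i ^ 2
  let Q₀ := ∑ i, Matrix.vecMulVec (v i) (v i)
  have hQ₀ : Q₀.PosSemidef := Matrix.posSemidef_sum _ fun i _ => posSemidef_vecMulVec_self _
  have hker : ∀ x, monoVec d x ⬝ᵥ (Q₀ *ᵥ monoVec d x) = eval x f := by
    intro x
    simp only [Q₀, Matrix.sum_mulVec, dotProduct_sum, dotProduct_vecMulVec_mulVec, hv, f, map_sum,
      map_mul, pow_two]
  let N : ℝ := (Fintype.card (Equiv.Perm (Fin n)) : ℝ)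
  have hN : 0 < N := by simp only [N]; exact_mod_cast Fintype.card_pos
  -- Average over the group; since f is symmetric, every conjugate of Q₀ still represents f.
  let Q : Matrix (Sym (Fin n) d) (Sym (Fin n) d) ℝ :=
    N⁻¹ • ∑ σ : Equiv.Perm (Fin n), (permRep σ)ᵀ * Q₀ * permRep σ
  have hK : ∀ x y, monoVec d x ⬝ᵥ (Q *ᵥ monoVec d y) = N⁻¹ * ∑ σ : Equiv.Perm (Fin n),
      monoVec d (x ∘ σ.symm) ⬝ᵥ (Q₀ *ᵥ monoVec d (y ∘ σ.symm)) := by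
    intro x y
    simp only [Q, Matrix.smul_mulVec, dotProduct_smul, smul_eq_mul, Matrix.sum_mulVec,
      dotProduct_sum, dotProduct_conj_permRep_mulVec, permRep_mulVec_monoVec]
  refine ⟨Q, ⟨?_, forall_conj_permRep_eq_iff.mpr fun τ x y => ?_⟩, gramForm_eq_iff.mpr fun x => ?_⟩
  · refine Matrix.PosSemidef.smul (Matrix.posSemidef_sum _ fun σ _ => ?_) (by positivity)
    simpa using hQ₀.conjTranspose_mul_mul_same (permRep σ)
  · rw [hK, hK]
    congr 1
    exact Fintype.sum_equiv (Equiv.mulRight τ⁻¹) _ _ fun σ => rfl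
  · rw [hK]
    have : ∀ σ : Equiv.Perm (Fin n), monoVec d (x ∘ σ.symm) ⬝ᵥ (Q₀ *ᵥ monoVec d (x ∘ σ.symm)) =
        eval x f := by
      intro σ
      rw [hker, ← eval_rename, hf σ.symm]
    simp only [this, Finset.sum_const, Finset.card_univ, nsmul_eq_mul]
    simp only [N] at hN ⊢
    field_simp

/-- Diagonal values of the matrices in the Gram spectrahedron are bounded. -/
theorem exists_bound_symGramSpectrahedron (f : MvPolynomial (Fin n) ℝ)
    (v : Sym (Fin n) d → ℝ) : ∃ C, ∀ Q ∈ symGramSpectrahedron n d f, v ⬝ᵥ (Q *ᵥ v) ≤ C := by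
  have hv : v ∈ Submodule.span ℝ (Set.range (monoVec (n := n) d)) := by
    rw [span_range_monoVec]; trivial
  induction hv using Submodule.span_induction with
  | mem v hv =>
    obtain ⟨x, rfl⟩ := hv
    exact ⟨eval x f, fun Q hQ => (gramForm_eq_iff.mp hQ.2 x).le⟩
  | zero => exact ⟨0, by simp⟩
  | add u v _ _ hu hv =>
    obtain ⟨C₁, h₁⟩ := hu
    obtain ⟨C₂, h₂⟩ := hv
    -- Parallelogram law, with the nonnegative value at u − v dropped.
    refine ⟨2 * C₁ + 2 * C₂, fun Q hQ => ?_⟩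
    have h := hQ.1.1.dotProduct_mulVec_nonneg (u - v)
    have e₁ := h₁ Q hQ
    have e₂ := h₂ Q hQ
    simp only [star_trivial, Matrix.mulVec_sub, Matrix.mulVec_add, dotProduct_sub, sub_dotProduct,
      dotProduct_add, add_dotProduct] at h ⊢
    linarith
  | smul a v _ hv =>
    obtain ⟨C, h⟩ := hv
    refine ⟨a * (a * C), fun Q hQ => ?_⟩
    simp only [Matrix.mulVec_smul, dotProduct_smul, smul_dotProduct, smul_eq_mul]
    have := mul_le_mul_of_nonneg_left (h Q hQ) (mul_self_nonneg a)
    linarith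

theorem isClosed_posSemidef {ι : Type*} [Fintype ι] :
    IsClosed {Q : Matrix ι ι ℝ | Q.PosSemidef} := by
  simp only [Matrix.posSemidef_iff_dotProduct_mulVec, Set.ofPred_and, Set.ofPred_forall]
  refine IsClosed.inter (isClosed_eq (by fun_prop) (by fun_prop)) (isClosed_iInter fun v => ?_)
  exact isClosed_le continuous_const (by fun_prop)

theorem isCompact_symGramSpectrahedron (f : MvPolynomial (Fin n) ℝ) :
    IsCompact (symGramSpectrahedron n d f) := by
  have hclosed : IsClosed (symGramSpectrahedron n d f) := by
    simp only [symGramSpectrahedron, symPSDCone, gramForm_eq_iff, Set.ofPred_and,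
      Set.ofPred_forall]
    refine (isClosed_posSemidef.inter (isClosed_iInter fun σ => ?_)).inter
      (isClosed_iInter fun x => ?_)
    · exact isClosed_eq (by fun_prop) (by fun_prop)
    · exact isClosed_eq (by fun_prop) (by fun_prop)
  choose C hC using exists_bound_symGramSpectrahedron (d := d) f
  let c : Sym (Fin n) d → ℝ := fun s => C (Pi.single s 1)
  have hcomp : IsCompact (Set.univ.pi fun s => Set.univ.pi fun t =>
      Set.Icc (-√(c s * c t)) √(c s * c t) : Set (Sym (Fin n) d → Sym (Fin n) d → ℝ)) :=
    isCompact_univ_pi fun s => isCompact_univ_pi fun t => isCompact_Icc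
  refine hcomp.of_isClosed_subset hclosed fun Q hQ s _ t _ => ?_
  have hd : ∀ s, Q s s ≤ c s := by
    intro s
    simpa [Matrix.mulVec, dotProduct, Pi.single_apply] using hC (Pi.single s 1) Q hQ
  have hnn : ∀ s, 0 ≤ Q s s := fun s => hQ.1.1.diag_nonneg
  rw [Set.mem_Icc, ← abs_le]
  refine Real.abs_le_sqrt ((hQ.1.1.sq_apply_le s t).trans ?_)
  exact mul_le_mul (hd s) (hd t) (hnn t) ((hnn s).trans (hd s))

/-- A matrix of minimal rank can be replaced by an extreme point of at most the same rank. -/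
theorem exists_extremePoint_rank_le {f : MvPolynomial (Fin n) ℝ}
    {Q : Matrix (Sym (Fin n) d) (Sym (Fin n) d) ℝ} (hQ : Q ∈ symGramSpectrahedron n d f) :
    ∃ Q' ∈ (symGramSpectrahedron n d f).extremePoints ℝ, Q'.rank ≤ Q.rank := by
  -- F is the face cut out by the kernel of Q: if a positive combination of positive semidefinite
  -- matrices kills v, each of them does.
  let F : Set (Matrix (Sym (Fin n) d) (Sym (Fin n) d) ℝ) :=
    {R | R ∈ symGramSpectrahedron n d f ∧ ∀ v, Q *ᵥ v = 0 → R *ᵥ v = 0}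
  have hF : IsExtreme ℝ (symGramSpectrahedron n d f) F := by
    refine ⟨fun R hR => hR.1, ?_⟩
    rintro R₁ h₁ R₂ h₂ R hR ⟨a, b, ha, hb, -, rfl⟩
    refine ⟨h₁, fun v hv => (h₁.1.1.dotProduct_mulVec_zero_iff v).mp ?_⟩
    have h := congrArg (v ⬝ᵥ ·) (hR.2 v hv)
    simp only [Matrix.add_mulVec, Matrix.smul_mulVec, dotProduct_add, dotProduct_smul,
      dotProduct_zero, smul_eq_mul] at h
    have n₁ := h₁.1.1.dotProduct_mulVec_nonneg v
    have n₂ := h₂.1.1.dotProduct_mulVec_nonneg v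
    simp only [star_trivial] at n₁ n₂ ⊢
    have := mul_nonneg ha.le n₁
    have := mul_nonneg hb.le n₂
    have h0 : a * (v ⬝ᵥ R₁ *ᵥ v) = 0 := by linarith
    exact (mul_eq_zero.mp h0).resolve_left ha.ne'
  have hclosed : IsClosed {R : Matrix (Sym (Fin n) d) (Sym (Fin n) d) ℝ |
      ∀ v, Q *ᵥ v = 0 → R *ᵥ v = 0} := by
    simp only [Set.ofPred_forall]
    exact isClosed_iInter fun v => isClosed_iInter fun _ =>
      isClosed_eq (by fun_prop) continuous_const
  have hFc : IsCompact F := (isCompact_symGramSpectrahedron f).inter_right hclosed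
  have : LocallyConvexSpace ℝ (Matrix (Sym (Fin n) d) (Sym (Fin n) d) ℝ) :=
    inferInstanceAs (LocallyConvexSpace ℝ (Sym (Fin n) d → Sym (Fin n) d → ℝ))
  obtain ⟨R, hR⟩ := hFc.extremePoints_nonempty ⟨Q, hQ, fun _ h => h⟩
  refine ⟨R, hF.extremePoints_subset_extremePoints hR, ?_⟩
  have hle : LinearMap.ker Q.mulVecLin ≤ LinearMap.ker R.mulVecLin := fun v hv => hR.1.2 v hv
  have h₁ := Q.mulVecLin.finrank_range_add_finrank_ker
  have h₂ := R.mulVecLin.finrank_range_add_finrank_ker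
  have h₃ := Submodule.finrank_mono hle
  simp only [Matrix.rank]
  omega

end

/-! ### Isotypic decomposition of the cubic forms; from blocks to Gram matrices. -/

noncomputable section

/-- The value of `devVar k` at `x`. -/
theorem eval_devVar (x : Fin 3 → ℝ) (k : Fin 3) :
    eval x (devVar k) = 3 * x k - (x 0 + x 1 + x 2) := by
  simp [devVar, sumVar]

theorem devVar_two : devVar 2 = -(devVar 0 + devVar 1) := by
  simp only [devVar, sumVar]; ring

/-- The three invariant cubic forms. -/
def invForm : Fin 3 → MvPolynomial (Fin 3) ℝ := ![sumVar ^ 3, sumVar * devQuad, devCub]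

/-- The three copies of the standard representation in the cubic forms. -/
def stdForm (i k : Fin 3) : MvPolynomial (Fin 3) ℝ :=
  ![sumVar ^ 2 * devVar k, sumVar * (devVar k ^ 2 - 2 * devQuad), devQuad * devVar k] i

theorem isHomogeneous_sumVar : sumVar.IsHomogeneous 1 :=
  ((isHomogeneous_X _ _).add (isHomogeneous_X _ _)).add (isHomogeneous_X _ _)

theorem isHomogeneous_devVar (k : Fin 3) : (devVar k).IsHomogeneous 1 := by
  have : (3 * X k : MvPolynomial (Fin 3) ℝ) = C 3 * X k := by rw [map_ofNat]
  rw [devVar, this]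
  exact ((isHomogeneous_X _ _).C_mul 3).sub isHomogeneous_sumVar

theorem isHomogeneous_devQuad : devQuad.IsHomogeneous 2 :=
  ((((isHomogeneous_devVar 0).pow 2).add ((isHomogeneous_devVar 1).pow 2)).add
    ((isHomogeneous_devVar 2).pow 2)).C_mul _

theorem isHomogeneous_devCub : devCub.IsHomogeneous 3 :=
  (((isHomogeneous_devVar 0).mul (isHomogeneous_devVar 1)).mul (isHomogeneous_devVar 2)).C_mul _

theorem isHomogeneous_devAlt : devAlt.IsHomogeneous 3 :=
  (((isHomogeneous_devVar 0).sub (isHomogeneous_devVar 1)).mul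
    ((isHomogeneous_devVar 0).sub (isHomogeneous_devVar 2))).mul
    ((isHomogeneous_devVar 1).sub (isHomogeneous_devVar 2))

theorem isHomogeneous_invForm (i : Fin 3) : (invForm i).IsHomogeneous 3 := by
  fin_cases i
  · exact isHomogeneous_sumVar.pow 3
  · exact isHomogeneous_sumVar.mul isHomogeneous_devQuad
  · exact isHomogeneous_devCub

theorem isHomogeneous_stdForm (i k : Fin 3) : (stdForm i k).IsHomogeneous 3 := by
  fin_cases i
  · exact (isHomogeneous_sumVar.pow 2).mul (isHomogeneous_devVar k)
  · have : (2 * devQuad : MvPolynomial (Fin 3) ℝ) = C 2 * devQuad := by rw [map_ofNat]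
    simp only [stdForm, this]
    exact isHomogeneous_sumVar.mul
      (((isHomogeneous_devVar k).pow 2).sub (isHomogeneous_devQuad.C_mul 2))
  · exact isHomogeneous_devQuad.mul (isHomogeneous_devVar k)

theorem sum_stdForm (i : Fin 3) : stdForm i 0 + stdForm i 1 + stdForm i 2 = 0 := by
  -- The factor C (1/6) in `devQuad` is an atom for `ring`; this relation cancels it.
  have h6 : (6 : MvPolynomial (Fin 3) ℝ) * C (1 / 6) = 1 := by
    rw [← map_ofNat C, ← C_mul]; norm_num
  fin_cases i
  · simp only [stdForm, devVar_two]; simp; ring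
  · simp only [stdForm, devQuad, devVar_two]; simp only [Fin.mk_one, Matrix.cons_val_one,
      Matrix.cons_val_zero]
    linear_combination (-2 * sumVar * (devVar 0 ^ 2 + devVar 0 * devVar 1 + devVar 1 ^ 2)) * h6
  · simp only [stdForm, devVar_two]; simp; ring

section Action

variable (σ : Equiv.Perm (Fin 3)) (x y : Fin 3 → ℝ)

theorem eval_comp_sumVar : eval (x ∘ σ) sumVar = eval x sumVar := by
  have := Equiv.sum_comp σ x
  simpa [sumVar, Fin.sum_univ_three] using this

theorem eval_comp_devVar (k : Fin 3) : eval (x ∘ σ) (devVar k) = eval x (devVar (σ k)) := by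
  have := eval_comp_sumVar σ x
  simp only [devVar, map_sub, map_mul, this, eval_X, map_ofNat, Function.comp]

theorem eval_comp_devQuad : eval (x ∘ σ) devQuad = eval x devQuad := by
  have := Equiv.sum_comp σ fun k => eval x (devVar k) ^ 2
  simp only [Fin.sum_univ_three] at this
  simp only [devQuad, map_mul, map_add, map_pow, eval_C, eval_comp_devVar, this]

theorem eval_comp_devCub : eval (x ∘ σ) devCub = eval x devCub := by
  have := Equiv.prod_comp σ fun k => eval x (devVar k)
  simp only [Fin.prod_univ_three] at this
  simp only [devCub, map_mul, eval_C, eval_comp_devVar, this]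

/-- Each factor changes by the sign of σ, and the two signs cancel. -/
theorem eval_comp_devAlt_mul :
    eval (x ∘ σ) devAlt * eval (y ∘ σ) devAlt = eval x devAlt * eval y devAlt := by
  simp only [devAlt, map_mul, map_sub, eval_comp_devVar]
  have h01 : σ 0 ≠ σ 1 := fun h => absurd (σ.injective h) (by decide)
  have h02 : σ 0 ≠ σ 2 := fun h => absurd (σ.injective h) (by decide)
  have h12 : σ 1 ≠ σ 2 := fun h => absurd (σ.injective h) (by decide)
  generalize σ 0 = i at *
  generalize σ 1 = j at *
  generalize σ 2 = k at *
  fin_cases i <;> fin_cases j <;> fin_cases k <;> simp at h01 h02 h12 ⊢ <;> ring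

theorem eval_comp_invForm (i : Fin 3) : eval (x ∘ σ) (invForm i) = eval x (invForm i) := by
  fin_cases i <;> simp [invForm, eval_comp_sumVar, eval_comp_devQuad, eval_comp_devCub]

theorem eval_comp_stdForm (i k : Fin 3) :
    eval (x ∘ σ) (stdForm i k) = eval x (stdForm i (σ k)) := by
  fin_cases i <;> simp [stdForm, eval_comp_sumVar, eval_comp_devQuad, eval_comp_devVar]

end Action

/-- The symmetric sextic attached to blocks, as a sum over the isotypic components. -/
theorem eval_symSextic_gramCoord {A B : Matrix (Fin 3) (Fin 3) ℝ} (hA : A.IsSymm) (hB : B.IsSymm)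
    (c : ℝ) (x : Fin 3 → ℝ) : eval x (symSextic (gramCoord A B c)) =
      ∑ i, ∑ j, A i j * (eval x (invForm i) * eval x (invForm j))
      + 1 / 6 * ∑ i, ∑ j, B i j * ∑ k, eval x (stdForm i k) * eval x (stdForm j k)
      + c / 108 * eval x devAlt ^ 2 := by
  have a10 : A 1 0 = A 0 1 := hA.apply 0 1
  have a20 : A 2 0 = A 0 2 := hA.apply 0 2
  have a21 : A 2 1 = A 1 2 := hA.apply 1 2
  have b10 : B 1 0 = B 0 1 := hB.apply 0 1
  have b20 : B 2 0 = B 0 2 := hB.apply 0 2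
  have b21 : B 2 1 = B 1 2 := hB.apply 1 2
  simp [symSextic, gramCoord, sexticBasis, Fin.sum_univ_succ, invForm, stdForm, devQuad, devCub,
    devAlt, a10, a20, a21, b10, b20, b21]
  -- Eliminating the dependent deviation leaves a polynomial identity in e, y₀, y₁. The constants
  -- reflect ∑ yₖ² = 6q and `devAlt`² = 108(q³ − r²).
  have h2 : eval x (devVar 2) = -(eval x (devVar 0) + eval x (devVar 1)) := by
    rw [devVar_two]; simp
  rw [h2]
  generalize eval x (devVar 0) = y₀
  generalize eval x (devVar 1) = y₁
  generalize eval x sumVar = e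
  ring

/-- An invariant Gram matrix with standard block of rank at most one. -/
theorem exists_mem_symPSDCone_of_blocks {A : Matrix (Fin 3) (Fin 3) ℝ} (hA : A.PosSemidef)
    (w : Fin 3 → ℝ) {c : ℝ} (hc : 0 ≤ c) :
    ∃ Q ∈ symPSDCone 3 3, gramForm Q = symSextic (gramCoord A (Matrix.vecMulVec w w) c) ∧
      Q.rank ≤ A.rank + (if w = 0 then 0 else 2) + (if c = 0 then 0 else 1) := by
  choose s hs using fun i => exists_dotProduct_monoVec_eq (isHomogeneous_invForm i)
  choose z hz using fun i k => exists_dotProduct_monoVec_eq (isHomogeneous_stdForm i k)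
  obtain ⟨δ, hδ⟩ := exists_dotProduct_monoVec_eq isHomogeneous_devAlt
  let S : Matrix (Sym (Fin 3) 3) (Fin 3) ℝ := Matrix.of fun t i => s i t
  let ζ : Fin 3 → Sym (Fin 3) 3 → ℝ := fun k => ∑ i, w i • z i k
  have hS : ∀ x, Sᵀ *ᵥ monoVec 3 x = fun i => eval x (invForm i) := fun x => by
    ext i; exact hs i x
  have hζ : ∀ k x, ζ k ⬝ᵥ monoVec 3 x = ∑ i, w i * eval x (stdForm i k) := fun k x => by
    simp only [ζ, sum_dotProduct, smul_dotProduct, hz, smul_eq_mul]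
  have hsum : ζ 2 = -(ζ 0 + ζ 1) := by
    refine sub_eq_zero.mp (eq_zero_of_forall_dotProduct_monoVec fun x => ?_)
    have hst : ∀ i, eval x (stdForm i 2) = -(eval x (stdForm i 0) + eval x (stdForm i 1)) := by
      intro i
      have := congrArg (eval x) (sum_stdForm i)
      simp only [map_add, map_zero] at this
      linarith
    simp only [sub_dotProduct, neg_dotProduct, add_dotProduct, hζ, Fin.sum_univ_three, hst]
    ring
  let Q₁ := S * A * Sᵀ
  let Q₂ := (1 / 6 : ℝ) • ∑ k, Matrix.vecMulVec (ζ k) (ζ k)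
  let Q₃ := (c / 108) • Matrix.vecMulVec δ δ
  have hK : ∀ x y, monoVec 3 x ⬝ᵥ ((Q₁ + Q₂ + Q₃) *ᵥ monoVec 3 y) =
      ∑ i, ∑ j, A i j * (eval x (invForm i) * eval y (invForm j))
      + 1 / 6 * ∑ k, (∑ i, w i * eval x (stdForm i k)) * (∑ i, w i * eval y (stdForm i k))
      + c / 108 * (eval x devAlt * eval y devAlt) := by
    intro x y
    have e₁ : monoVec 3 x ⬝ᵥ (Q₁ *ᵥ monoVec 3 y) =
        ∑ i, ∑ j, A i j * (eval x (invForm i) * eval y (invForm j)) := by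
      simp only [Q₁]
      rw [← Matrix.mulVec_mulVec, ← Matrix.mulVec_mulVec, hS, Matrix.dotProduct_mulVec,
        ← Matrix.mulVec_transpose, hS]
      simp only [dotProduct, Matrix.mulVec, Finset.mul_sum]
      refine Finset.sum_congr rfl fun i _ => Finset.sum_congr rfl fun j _ => by ring
    simp only [Matrix.add_mulVec, dotProduct_add, e₁, Q₂, Q₃, Matrix.smul_mulVec, dotProduct_smul,
      Matrix.sum_mulVec, dotProduct_sum, dotProduct_vecMulVec_mulVec, hζ, hδ, smul_eq_mul]
  refine ⟨Q₁ + Q₂ + Q₃, ⟨?_, forall_conj_permRep_eq_iff.mpr fun σ x y => ?_⟩,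
    gramForm_eq_iff.mpr fun x => ?_, ?_⟩
  · refine ((?_ : Q₁.PosSemidef).add (?_ : Q₂.PosSemidef)).add (?_ : Q₃.PosSemidef)
    · simpa using hA.mul_mul_conjTranspose_same S
    · exact (Matrix.posSemidef_sum _ fun k _ => posSemidef_vecMulVec_self _).smul (by norm_num)
    · exact (posSemidef_vecMulVec_self _).smul (by positivity)
  · rw [hK, hK]
    simp only [eval_comp_invForm, eval_comp_stdForm, eval_comp_devAlt_mul]
    rw [Equiv.sum_comp σ fun k => (∑ i, w i * eval x (stdForm i k)) *
      (∑ i, w i * eval y (stdForm i k))]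
  · rw [hK, eval_symSextic_gramCoord hA.isSymm (posSemidef_vecMulVec_self w).isSymm]
    simp only [Matrix.vecMulVec_apply, Fin.sum_univ_three]
    ring
  · have r₁ : Q₁.rank ≤ A.rank := (Matrix.rank_mul_le_left _ _).trans (Matrix.rank_mul_le_right _ _)
    have r₂ : Q₂.rank ≤ if w = 0 then 0 else 2 := by
      split_ifs with hw
      · simp [Q₂, ζ, hw]
      -- As ζ₂ = −(ζ₀ + ζ₁), three outer products collapse to two.
      · have : Q₂ = Matrix.vecMulVec ((1 / 6 : ℝ) • ζ 0) (2 • ζ 0 + ζ 1)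
            + Matrix.vecMulVec ((1 / 6 : ℝ) • ζ 1) (ζ 0 + 2 • ζ 1) := by
          ext s t
          simp [Q₂, Fin.sum_univ_three, hsum, Matrix.vecMulVec_apply]
          ring
        rw [this]
        refine (Matrix.rank_add_le_rank_add_rank _ _).trans ?_
        exact add_le_add (Matrix.rank_vecMulVec_le _ _) (Matrix.rank_vecMulVec_le _ _)
    have r₃ : Q₃.rank ≤ if c = 0 then 0 else 1 := by
      split_ifs with hc
      · simp [Q₃, hc]
      · simp only [Q₃, ← Matrix.smul_vecMulVec]
        exact Matrix.rank_vecMulVec_le _ _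
    have h₁ := Matrix.rank_add_le_rank_add_rank (Q₁ + Q₂) Q₃
    have h₂ := Matrix.rank_add_le_rank_add_rank Q₁ Q₂
    omega

end

/-! ### Dual vectors; from Gram matrices to blocks. -/

noncomputable section

/-- The point `3 ε_k - (1, 1, 1)`. -/
def devPoint (k : Fin 3) : Fin 3 → ℝ := fun i => if i = k then 2 else -1

/-- Vectors dual to the invariant cubic forms. -/
def invVec : Fin 3 → Sym (Fin 3) 3 → ℝ :=
  -- With d = `devPoint k`, sums and differences of m(1 + d) and m(1 − d) isolate the parts of m(1 +
  -- d) of each degree in d. Summing over k gives the invariant component.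
  ![(1 / 27 : ℝ) • monoVec 3 1,
    (1 / 162 : ℝ) • ∑ k, (monoVec 3 (1 + devPoint k) + monoVec 3 (1 - devPoint k)
      - (2 : ℝ) • monoVec 3 1),
    (1 / 81 : ℝ) • ∑ k, monoVec 3 (devPoint k)]

/-- Vectors dual to the three copies of the standard representation in the cubic forms. -/
def stdVec (i k : Fin 3) : Sym (Fin 3) 3 → ℝ :=
  ![(1 / 54 : ℝ) • (monoVec 3 (1 + devPoint k) - monoVec 3 (1 - devPoint k)
      - (2 : ℝ) • monoVec 3 (devPoint k)),
    (1 / 54 : ℝ) • (monoVec 3 (1 + devPoint k) + monoVec 3 (1 - devPoint k)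
      - (2 : ℝ) • monoVec 3 1) - invVec 1,
    (1 / 27 : ℝ) • monoVec 3 (devPoint k) - invVec 2] i

/-- The vector dual to the alternating cubic form. -/
def altVec : Sym (Fin 3) 3 → ℝ :=
  (1 / 324 : ℝ) • (monoVec 3 ![1, 0, -1] + monoVec 3 ![0, -1, 1] + monoVec 3 ![-1, 1, 0]
    - monoVec 3 ![-1, 0, 1] - monoVec 3 ![0, 1, -1] - monoVec 3 ![1, -1, 0])

theorem exists_monoVec_apply_eq (s : Sym (Fin 3) 3) :
    ∃ i j k : Fin 3, ∀ p : Fin 3 → ℝ, monoVec 3 p s = p i * p j * p k := by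
  obtain ⟨i, j, k, h⟩ := Multiset.card_eq_three.mp s.card_coe
  refine ⟨i, j, k, fun p => ?_⟩
  rw [monoVec_apply, h]
  simp [mul_assoc]

/-- Decomposition of the vector of monomials into isotypic components. -/
theorem monoVec_eq_sum (x : Fin 3 → ℝ) : monoVec 3 x = ∑ i, eval x (invForm i) • invVec i
    + (1 / 3 : ℝ) • ∑ i, ∑ k, eval x (stdForm i k) • stdVec i k + eval x devAlt • altVec := by
  ext s
  obtain ⟨i, j, k, hs⟩ := exists_monoVec_apply_eq s
  have hI0 : invVec 0 s = 1 / 27 := by simp [invVec, hs]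
  have hI1 : invVec 1 s = 1 / 81 * ∑ l, (devPoint l i * devPoint l j + devPoint l i * devPoint l k
      + devPoint l j * devPoint l k) := by
    simp [invVec, hs, Fin.sum_univ_three]; ring
  have hI2 : invVec 2 s = 1 / 81 * ∑ l, devPoint l i * devPoint l j * devPoint l k := by
    simp [invVec, hs, Fin.sum_univ_three]; ring
  have hS0 : ∀ l, stdVec 0 l s = 1 / 27 * (devPoint l i + devPoint l j + devPoint l k) := by
    intro l; simp [stdVec, hs]; ring
  have hS1 : ∀ l, stdVec 1 l s = 1 / 27 * (devPoint l i * devPoint l j + devPoint l i * devPoint l k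
      + devPoint l j * devPoint l k) - invVec 1 s := by
    intro l; simp [stdVec, hs]; ring
  have hS2 : ∀ l, stdVec 2 l s = 1 / 27 * (devPoint l i * devPoint l j * devPoint l k)
      - invVec 2 s := by
    intro l; simp [stdVec, hs]
  have hf : ∀ l, stdForm 0 l = sumVar ^ 2 * devVar l := fun _ => rfl
  have hf1 : ∀ l, stdForm 1 l = sumVar * (devVar l ^ 2 - 2 * devQuad) := fun _ => rfl
  have hf2 : ∀ l, stdForm 2 l = devQuad * devVar l := fun _ => rfl
  have hg0 : invForm 0 = sumVar ^ 3 := rfl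
  have hg1 : invForm 1 = sumVar * devQuad := rfl
  have hg2 : invForm 2 = devCub := rfl
  -- In terms of e and the deviations the claim becomes a polynomial identity for each monomial x_i
  -- x_j x_k.
  have hx : ∀ l, x l = (eval x sumVar + eval x (devVar l)) / 3 := fun l => by
    simp [eval_devVar, sumVar]
  have h2 : eval x (devVar 2) = -(eval x (devVar 0) + eval x (devVar 1)) := by
    rw [devVar_two]; simp
  simp only [Pi.add_apply, Pi.smul_apply, smul_eq_mul, Fin.sum_univ_three, hS0,
    hS1, hS2, hI0, hI1, hI2, hf, hf1, hf2, hg0, hg1, hg2, devQuad, devCub, devAlt, map_mul, map_add,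
    map_sub, map_pow, eval_C, map_ofNat]
  rw [hs, hx i, hx j, hx k]
  simp only [altVec, Pi.add_apply, Pi.smul_apply, Pi.sub_apply, smul_eq_mul, hs]
  clear hI0 hI1 hI2 hS0 hS1 hS2 hx hs hf hf1 hf2 hg0 hg1 hg2
  generalize eval x sumVar = e
  generalize hy : (fun l => eval x (devVar l)) = y
  have hy' : ∀ l, eval x (devVar l) = y l := fun l => by rw [← hy]
  simp only [hy'] at h2 ⊢
  clear hy hy'
  have d : ∀ l m, devPoint l m = if m = l then 2 else -1 := fun _ _ => rfl
  fin_cases i <;> fin_cases j <;> fin_cases k <;> simp [d, h2] <;> ring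

theorem sum_stdVec (i : Fin 3) : stdVec i 0 + stdVec i 1 + stdVec i 2 = 0 := by
  ext s
  obtain ⟨a, b, c, hs⟩ := exists_monoVec_apply_eq s
  have h : ∀ a : Fin 3, devPoint 2 a = -(devPoint 0 a + devPoint 1 a) := fun a => by
    fin_cases a <;> simp [devPoint] <;> norm_num
  fin_cases i
  · simp only [stdVec, Fin.zero_eta, Matrix.cons_val_zero, Pi.add_apply, Pi.sub_apply,
      Pi.smul_apply, smul_eq_mul, hs, h, Pi.one_apply, Pi.zero_apply]
    ring
  · simp [stdVec, invVec, Fin.sum_univ_three]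
    ring
  · simp [stdVec, invVec, Fin.sum_univ_three]
    ring

section Action

variable (σ : Equiv.Perm (Fin 3))

theorem devPoint_comp_symm (k : Fin 3) : devPoint k ∘ σ.symm = devPoint (σ k) := by
  ext i
  simp [devPoint, Equiv.symm_apply_eq]

theorem permRep_mulVec_invVec (i : Fin 3) : permRep σ *ᵥ invVec i = invVec i := by
  have h1 : ∀ k, (1 + devPoint k) ∘ σ.symm = 1 + devPoint (σ k) := fun k => by
    rw [← devPoint_comp_symm]; rfl
  have h2 : ∀ k, (1 - devPoint k) ∘ σ.symm = 1 - devPoint (σ k) := fun k => by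
    rw [← devPoint_comp_symm]; rfl
  have h3 : (1 : Fin 3 → ℝ) ∘ σ.symm = 1 := rfl
  fin_cases i
  · simp [invVec, Matrix.mulVec_smul, permRep_mulVec_monoVec, h3]
  · have := Equiv.sum_comp σ fun k => monoVec 3 (1 + devPoint k) + monoVec 3 (1 - devPoint k)
      - (2 : ℝ) • monoVec 3 1
    simp only [invVec, Fin.mk_one, Matrix.cons_val_one, Matrix.cons_val_zero, Matrix.mulVec_smul,
      Matrix.mulVec_sum, Matrix.mulVec_sub, Matrix.mulVec_add, permRep_mulVec_monoVec, h1, h2, h3,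
      this]
  · have := Equiv.sum_comp σ fun k => monoVec 3 (devPoint k)
    simp only [invVec, Fin.reduceFinMk, Matrix.cons_val, Matrix.mulVec_smul,
      Matrix.mulVec_sum, permRep_mulVec_monoVec, devPoint_comp_symm, this]

theorem permRep_mulVec_stdVec (i k : Fin 3) : permRep σ *ᵥ stdVec i k = stdVec i (σ k) := by
  have h1 : ∀ k, (1 + devPoint k) ∘ σ.symm = 1 + devPoint (σ k) := fun k => by
    rw [← devPoint_comp_symm]; rfl
  have h2 : ∀ k, (1 - devPoint k) ∘ σ.symm = 1 - devPoint (σ k) := fun k => by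
    rw [← devPoint_comp_symm]; rfl
  have h3 : (1 : Fin 3 → ℝ) ∘ σ.symm = 1 := rfl
  fin_cases i <;>
  simp [stdVec, Matrix.mulVec_smul, Matrix.mulVec_sub, Matrix.mulVec_add, permRep_mulVec_invVec,
    permRep_mulVec_monoVec, h1, h2, h3, devPoint_comp_symm]

theorem permRep_swap_mulVec_altVec {i j : Fin 3} (hij : i ≠ j) :
    permRep (Equiv.swap i j) *ᵥ altVec = -altVec := by
  have e : ∀ (p : Fin 3 → ℝ), p ∘ (Equiv.swap i j) = ![p (Equiv.swap i j 0), p (Equiv.swap i j 1),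
      p (Equiv.swap i j 2)] := fun p => by ext k; fin_cases k <;> rfl
  simp only [altVec, Matrix.mulVec_smul, Matrix.mulVec_sub, Matrix.mulVec_add,
    permRep_mulVec_monoVec, Equiv.symm_swap, e, ← smul_neg]
  congr 1
  fin_cases i <;> fin_cases j <;> simp [Equiv.swap_apply_def] at hij ⊢ <;> abel

end Action
end

/-- Block diagonalization of the matrices in the symmetry adapted cone. -/
theorem exists_blocks_of_mem_symPSDCone {Q : Matrix (Sym (Fin 3) 3) (Sym (Fin 3) 3) ℝ}
    (hQ : Q ∈ symPSDCone 3 3) : ∃ (A B : Matrix (Fin 3) (Fin 3) ℝ) (c : ℝ), A.PosSemidef ∧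
      B.PosSemidef ∧ 0 ≤ c ∧ gramForm Q = symSextic (gramCoord A B c) ∧
      A.rank + 2 * B.rank + (if c = 0 then 0 else 1) ≤ Q.rank := by
  obtain ⟨hpsd, hinv⟩ := hQ
  let β : (Sym (Fin 3) 3 → ℝ) → (Sym (Fin 3) 3 → ℝ) → ℝ := fun u v => u ⬝ᵥ (Q *ᵥ v)
  have βdef : ∀ u v, u ⬝ᵥ (Q *ᵥ v) = β u v := fun _ _ => rfl
  have βinv : ∀ (σ : Equiv.Perm (Fin 3)) u v, β (permRep σ *ᵥ u) (permRep σ *ᵥ v) = β u v := by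
    intro σ u v
    simp only [β]
    rw [← dotProduct_conj_permRep_mulVec, hinv]
  have βsymm : ∀ u v, β u v = β v u := by
    intro u v
    simp only [β]
    rw [dotProduct_comm, Matrix.dotProduct_mulVec, ← Matrix.mulVec_transpose, hpsd.isSymm]
  have add_left : ∀ u v w, β (u + v) w = β u w + β v w := fun u v w => add_dotProduct _ _ _
  have add_right : ∀ u v w, β u (v + w) = β u v + β u w := fun u v w => by
    simp only [β, Matrix.mulVec_add, dotProduct_add]
  have sub_left : ∀ u v w, β (u - v) w = β u w - β v w := fun u v w => sub_dotProduct _ _ _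
  have sub_right : ∀ u v w, β u (v - w) = β u v - β u w := fun u v w => by
    simp only [β, Matrix.mulVec_sub, dotProduct_sub]
  have neg_left : ∀ u v, β (-u) v = -β u v := fun u v => neg_dotProduct _ _
  have smul_left : ∀ (a : ℝ) u v, β (a • u) v = a * β u v := fun a u v => smul_dotProduct _ _ _
  have smul_right : ∀ (a : ℝ) u v, β u (a • v) = a * β u v := fun a u v => by
    simp only [β, Matrix.mulVec_smul, dotProduct_smul, smul_eq_mul]
  have zero_right : ∀ u, β u 0 = 0 := fun u => by simp [β]
  -- Schur's lemma by hand: the value does not depend on k, and the three vectors sum to zero.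
  have inv_std : ∀ i j k, β (invVec i) (stdVec j k) = 0 := by
    intro i j
    have h : ∀ k, β (invVec i) (stdVec j k) = β (invVec i) (stdVec j 0) := fun k => by
      rw [← βinv (Equiv.swap 0 k) (invVec i) (stdVec j k), permRep_mulVec_invVec,
        permRep_mulVec_stdVec, Equiv.swap_apply_right]
    have hsum : β (invVec i) (stdVec j 0 + stdVec j 1 + stdVec j 2) = 0 := by
      rw [sum_stdVec, zero_right]
    rw [add_right, add_right, h 1, h 2] at hsum
    intro k
    rw [h k]; linarith
  have alt_std : ∀ j k, β altVec (stdVec j k) = 0 := by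
    -- The transposition fixing k fixes the standard vector and negates `altVec`.
    have h : ∀ j k a b, a ≠ b → Equiv.swap a b k = k → β altVec (stdVec j k) = 0 := by
      intro j k a b hab hk
      have := βinv (Equiv.swap a b) altVec (stdVec j k)
      rw [permRep_swap_mulVec_altVec hab, permRep_mulVec_stdVec, hk, neg_left] at this
      linarith
    intro j k
    fin_cases k
    · exact h j 0 1 2 (by decide) (by decide)
    · exact h j 1 0 2 (by decide) (by decide)
    · exact h j 2 0 1 (by decide) (by decide)
  have inv_alt : ∀ i, β (invVec i) altVec = 0 := by
    intro i
    have := βinv (Equiv.swap 0 1) (invVec i) altVec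
    rw [permRep_swap_mulVec_altVec (by decide), permRep_mulVec_invVec, βsymm, neg_left, βsymm]
      at this
    linarith
  have std_diag : ∀ i j k, β (stdVec i k) (stdVec j k) = β (stdVec i 0) (stdVec j 0) := by
    intro i j k
    rw [← βinv (Equiv.swap 0 k) (stdVec i k) (stdVec j k), permRep_mulVec_stdVec,
      permRep_mulVec_stdVec, Equiv.swap_apply_right]
  -- The two off-diagonal values at k agree by a transposition, and together with the diagonal value
  -- they sum to zero.
  have std_off : ∀ i j k l, k ≠ l →
      β (stdVec i k) (stdVec j l) = -(1 / 2) * β (stdVec i 0) (stdVec j 0) := by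
    intro i j k l hkl
    obtain ⟨m, hmk, hml, hs⟩ : ∃ m, m ≠ k ∧ m ≠ l ∧
        stdVec j k + stdVec j l + stdVec j m = 0 := by
      have := sum_stdVec j
      fin_cases k <;> fin_cases l <;> simp at hkl
      · exact ⟨2, by decide, by decide, this⟩
      · exact ⟨1, by decide, by decide, by rw [← this]; simp; abel⟩
      · exact ⟨2, by decide, by decide, by rw [← this]; simp; abel⟩
      · exact ⟨0, by decide, by decide, by rw [← this]; simp; abel⟩
      · exact ⟨1, by decide, by decide, by rw [← this]; simp; abel⟩
      · exact ⟨0, by decide, by decide, by rw [← this]; simp; abel⟩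
    have h1 : β (stdVec i k) (stdVec j m) = β (stdVec i k) (stdVec j l) := by
      rw [← βinv (Equiv.swap l m) (stdVec i k) (stdVec j m), permRep_mulVec_stdVec,
        permRep_mulVec_stdVec, Equiv.swap_apply_right,
        Equiv.swap_apply_of_ne_of_ne hkl (Ne.symm hmk)]
    have h2 : β (stdVec i k) (stdVec j k + stdVec j l + stdVec j m) = 0 := by
      rw [hs, zero_right]
    rw [add_right, add_right, h1, std_diag] at h2
    linarith
  let A : Matrix (Fin 3) (Fin 3) ℝ := Matrix.of fun i j => β (invVec i) (invVec j)
  let B : Matrix (Fin 3) (Fin 3) ℝ := Matrix.of fun i j => β (stdVec i 0) (stdVec j 0)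
  have std_std : ∀ i j k l, β (stdVec i k) (stdVec j l) =
      (if k = l then 1 else -(1 / 2)) * B i j := by
    intro i j k l
    simp only [B, Matrix.of_apply]
    split_ifs with h
    · subst h; rw [std_diag, one_mul]
    · exact std_off i j k l h
  have std_inv : ∀ i j k, β (stdVec j k) (invVec i) = 0 := fun i j k => by rw [βsymm, inv_std]
  have std_alt : ∀ j k, β (stdVec j k) altVec = 0 := fun j k => by rw [βsymm, alt_std]
  have alt_inv : ∀ i, β altVec (invVec i) = 0 := fun i => by rw [βsymm, inv_alt]
  have gram_psd : ∀ v : Fin 3 → Sym (Fin 3) 3 → ℝ,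
      (Matrix.of fun i j => β (v i) (v j)).PosSemidef := by
    intro v
    have := hpsd.mul_mul_conjTranspose_same (Matrix.of v)
    convert this using 1
    ext i j
    simp only [Matrix.of_apply, β, Matrix.mul_apply, dotProduct, Matrix.mulVec, Finset.mul_sum,
      Finset.sum_mul, Matrix.conjTranspose_apply, star_trivial]
    rw [Finset.sum_comm]
    simp only [mul_assoc]
  have hA : A.PosSemidef := gram_psd invVec
  have hB : B.PosSemidef := gram_psd fun i => stdVec i 0
  have hc : 0 ≤ β altVec altVec := by simpa [β] using hpsd.dotProduct_mulVec_nonneg altVec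
  -- The factor 108 undoes the normalization c/108 of `devAlt`² in `eval_symSextic_gramCoord`.
  refine ⟨A, B, 108 * β altVec altVec, hA, hB, by positivity, gramForm_eq_iff.mpr fun x => ?_, ?_⟩
  · rw [eval_symSextic_gramCoord hA.isSymm hB.isSymm, βdef, monoVec_eq_sum]
    have hz : ∀ i, eval x (stdForm i 2) = -(eval x (stdForm i 0) + eval x (stdForm i 1)) := by
      intro i
      have := congrArg (eval x) (sum_stdForm i)
      simp only [map_add, map_zero] at this
      linarith
    simp only [Fin.sum_univ_three, add_left, add_right, smul_left, smul_right, inv_std, std_inv,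
      alt_std, std_alt, inv_alt, alt_inv, std_std, A, Matrix.of_apply, hz]
    simp only [Fin.isValue, Fin.reduceEq, if_true, if_false]
    ring
  -- Each standard copy contributes its ±1 eigenvectors under the transposition of the last two
  -- indices, which are β-orthogonal. Thus B appears twice; the 1/3 cancels β(s₁ − s₂, s₁ − s₂) =
  -- 3β(s₀, s₀).
  · let u : (Fin 3 ⊕ Fin 3) ⊕ (Fin 3 ⊕ Unit) → Sym (Fin 3) 3 → ℝ :=
      Sum.elim (Sum.elim invVec fun i => stdVec i 0)
        (Sum.elim (fun i => (1 / 3 : ℝ) • (stdVec i 1 - stdVec i 2)) fun _ => altVec)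
    let v : (Fin 3 ⊕ Fin 3) ⊕ (Fin 3 ⊕ Unit) → Sym (Fin 3) 3 → ℝ :=
      Sum.elim (Sum.elim invVec fun i => stdVec i 0)
        (Sum.elim (fun i => stdVec i 1 - stdVec i 2) fun _ => altVec)
    let c' : Matrix Unit Unit ℝ := Matrix.of fun _ _ => β altVec altVec
    have hUV : Matrix.of u * Q * (Matrix.of v)ᵀ = Matrix.fromBlocks (Matrix.fromBlocks A 0 0 B) 0 0
        (Matrix.fromBlocks B 0 0 c') := by
      have hent : ∀ i j, (Matrix.of u * Q * (Matrix.of v)ᵀ) i j = β (u i) (v j) := by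
        intro i j
        simp only [β, Matrix.mul_apply, dotProduct, Matrix.mulVec, Finset.mul_sum,
          Finset.sum_mul, Matrix.transpose_apply, Matrix.of_apply]
        rw [Finset.sum_comm]
        simp only [mul_assoc]
      ext i j
      rw [hent]
      rcases i with (i | i) | (i | i) <;> rcases j with (j | j) | (j | j) <;>
        simp [u, v, A, c', inv_std, std_inv, alt_std, std_alt, inv_alt, alt_inv, std_std,
          sub_left, sub_right, smul_left] <;> ring
    have hr : (Matrix.of u * Q * (Matrix.of v)ᵀ).rank ≤ Q.rank :=
      (Matrix.rank_mul_le_left _ _).trans (Matrix.rank_mul_le_right _ _)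
    rw [hUV] at hr
    have h₁ := Matrix.rank_add_rank_le_rank_fromBlocks (Matrix.fromBlocks A 0 0 B)
      (Matrix.fromBlocks B 0 0 c')
    have h₂ := Matrix.rank_add_rank_le_rank_fromBlocks A B
    have h₃ := Matrix.rank_add_rank_le_rank_fromBlocks B c'
    have h₄ : (if 108 * β altVec altVec = 0 then 0 else 1) ≤ c'.rank := by
      split_ifs with h
      · exact Nat.zero_le _
      · by_contra hlt
        have := Matrix.det_eq_zero_of_rank_lt (A := c') (by simpa using hlt)
        simp [c'] at this
        exact h (by rw [this, mul_zero])
    omega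

/-! ### Assembly of the two bounds. -/

/-- The factor 2 forces rank B ≤ 1. If B has rank one, a single unit remains for A and c together;
if B = 0 and c ≠ 0, at most two remain for A. -/
theorem degenerateBlocks_of_rank_le {A B : Matrix (Fin 3) (Fin 3) ℝ} {c : ℝ} (hA : A.PosSemidef)
    (hB : B.PosSemidef) (h : A.rank + 2 * B.rank + (if c = 0 then 0 else 1) ≤ 3) :
    DegenerateBlocks A B c := by
  by_cases hB0 : B.rank = 0
  · refine Or.inl ⟨Matrix.eq_zero_of_rank_eq_zero hB0, ?_⟩
    by_cases hc : c = 0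
    · exact Or.inl hc
    · rw [if_neg hc] at h
      exact Or.inr (Matrix.det_eq_zero_of_rank_lt (by simp; omega))
  · obtain ⟨w, hw⟩ := hB.exists_eq_vecMulVec (by omega)
    refine Or.inr ⟨w, hw, ?_⟩
    by_cases hc : c = 0
    · exact Or.inr ⟨hA.exists_eq_vecMulVec (by omega), hc⟩
    · rw [if_neg hc] at h
      exact Or.inl (Matrix.eq_zero_of_rank_eq_zero (by omega))

/-- For a generic symmetric ternary sextic `f` (its seven coefficients avoid the zero set of some
fixed nonzero polynomial): if `f` is SOS, then every matrix in its symmetry adapted Gram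
spectrahedron has rank at least `4`, and some extreme point of it has rank `4`. -/
theorem mainTheorem7 :
    ∃ P : MvPolynomial (Fin 7) ℝ, P ≠ 0 ∧
      ∀ f : MvPolynomial (Fin 3) ℝ, f.IsSymmetric → f.IsHomogeneous 6 →
        MvPolynomial.eval (sexticCoeffs f) P ≠ 0 → IsSOSForm 3 3 f →
          (∀ Q ∈ symGramSpectrahedron 3 3 f, 4 ≤ Q.rank) ∧
          ∃ Q ∈ (symGramSpectrahedron 3 3 f).extremePoints ℝ, Q.rank = 4 := by
  obtain ⟨P, hP, hdeg⟩ := exists_relation_of_degenerateBlocks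
  refine ⟨P, hP, fun f hsymm _ hgen hsos => ?_⟩
  have hlow : ∀ Q ∈ symGramSpectrahedron 3 3 f, 4 ≤ Q.rank := by
    rintro Q ⟨hQ, hf⟩
    by_contra hlt
    obtain ⟨A, B, c, hA, hB, -, hform, hrank⟩ := exists_blocks_of_mem_symPSDCone hQ
    refine hgen ?_
    rw [← hf, hform]
    exact hdeg A B c hA.isSymm (degenerateBlocks_of_rank_le hA hB (by omega))
  refine ⟨hlow, ?_⟩
  obtain ⟨Q₀, hQ₀, hf₀⟩ := symGramSpectrahedron_nonempty hsymm hsos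
  obtain ⟨A, B, c, hA, hB, hc, hform, -⟩ := exists_blocks_of_mem_symPSDCone hQ₀
  obtain ⟨A', w, c', hA', hc', hcoord, hcases⟩ := exists_low_rank_blocks hA hB hc
  obtain ⟨Q, hQ, hQf, hQr⟩ := exists_mem_symPSDCone_of_blocks hA' w hc'
  have hmem : Q ∈ symGramSpectrahedron 3 3 f := ⟨hQ, by rw [hQf, hcoord, ← hform, hf₀]⟩
  have hle : Q.rank ≤ 4 := by
    have hA3 : A'.rank ≤ 3 := by simpa using A'.rank_le_card_height
    refine hQr.trans ?_
    -- The three cases give the bounds 3 + 0 + 1, 1 + 2 + 1 and 2 + 2 + 0.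
    rcases hcases with hw | ⟨s, rfl⟩ | ⟨hdet, hc0⟩
    · rw [if_pos hw]; split_ifs <;> omega
    · have := Matrix.rank_vecMulVec_le s s
      split_ifs <;> omega
    · have := Matrix.rank_lt_of_det_eq_zero hdet
      rw [if_pos hc0]
      simp at this
      split_ifs <;> omega
  obtain ⟨Q', hQ', hr⟩ := exists_extremePoint_rank_le hmem
  exact ⟨Q', hQ', le_antisymm (hr.trans hle) (hlow Q' hQ'.1)⟩
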